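/- Let $\mathbb S^1=\mathbb R/\mathbb Z=[0,1]/_{0\sim 1}$ and let $f:\mathbb S^1\to\mathbb R$ be continuous and non-constant. We use the following notions. - For a totally bounded metric space $X$, $N_r(X)$ is the minimal number of sets of diameter at most $r$ needed to cover $X$, and $\overline{\dim}_B X=\limsup_{r\to 0}\frac{\log N_r(X)}{-\log r}$. - $\Gamma(g)=\{(x,g(x)):x\in[0,1]\}\subset\mathbb R^2$ is the graph of $g\in C(\mathbb S^1)$. - $\mathcal T(f)$ is the real tree of $f$: choose $a\in\mathbb S^1$ at which $f$ is minimal and put $\tilde f(x)=f(x+a)-f(a)$ for $x\in[0,1]$; then $\mathcal T(f)$ is $[0,1]$ with the pseudometric $d(x,y)=d(y,x)=\tilde f(x)+\tilde f(y)-2\min_{[x,y]}\tilde f$ $(x\le y)$, points at distance $0$ being identified. - For $p\ge 1$, $V^p(f)=\sup\sum_{i}|f(x_i)-f(x_{i+1})|^p$ over all finite sequences $x_1<\dots<x_n$ in $[0,1]$, and the variation index is $I(f)=\sup\{p\ge 1: V^p(f)=\infty\}\in[1,\infty]$, which is $1$ if the set is empty. - $\mathrm{Homeo}(\mathbb S^1)$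 is the set of homeomorphisms $\mathbb S^1\to\mathbb S^1$ (time changes). Dimensions and indices take values in $[0,\infty]$, with $1/\infty=0$ and $1/0=\infty$. Then there exists $\overline\tau\in\mathrm{Homeo}(\mathbb S^1)$ such that $$\overline{\dim}_B\,\Gamma(f\circ\overline\tau)=2-\frac{1}{\overline{\dim}_B\,\mathcal T(f)}=2-\frac1{I(f)}.$$ In particular, for all $\tau\in\mathrm{Homeo}(\mathbb S^1)$, $$\frac{1}{2-\overline{\dim}_B\,\Gamma(f\circ\tau)}\;\le\;\overline{\dim}_B\,\mathcal T(f)\;=\;\max_{\kappa\in\mathrm{Homeo}(\mathbb S^1)}\frac{1}{2-\overline{\dim}_B\,\Gamma(f\circ\kappa)},$$ where the maximum is attained. -/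

import Mathlib

open Set Filter Topology
open scoped ENNReal

noncomputable section

namespace CircleTree

/-- `N_r(X)`: the minimal number of sets of diameter at most `r` needed to cover `X`
(`⊤` if there is no finite such cover). -/
def coverNumber (X : Type*) [PseudoMetricSpace X] (r : ℝ) : ℕ∞ :=
  ⨅ (n : ℕ) (_ : ∃ U : Fin n → Set X,
    (∀ i, Metric.ediam (U i) ≤ ENNReal.ofReal r) ∧ (⋃ i, U i) = univ), (n : ℕ∞)

/-- Upper box dimension `limsup_{r → 0+} log N_r(X) / (- log r)`, with values in `[0, ∞]`. The
quotient is non-negative when `r < 1` and `X` is non-empty. -/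
def upperBoxDim (X : Type*) [PseudoMetricSpace X] : ℝ≥0∞ :=
  limsup (fun r : ℝ =>
    (ENNReal.log (coverNumber X r : ℝ≥0∞) / ((-Real.log r : ℝ) : EReal)).toENNReal) (𝓝[>] 0)

/-- Excursion functions: continuous `e ≥ 0` on `[0,1]` with `e 0 = e 1 = 0`. -/
structure Excursion where
  toFun : C(unitInterval, ℝ)
  map_zero : toFun 0 = 0
  map_one : toFun 1 = 0
  nonneg : ∀ x, 0 ≤ toFun x

/-- The minimum of `e` on the closed interval between `x` and `y` (in either order). -/
def Excursion.minOn (e : Excursion) (x y : unitInterval) : ℝ :=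
  sInf (e.toFun '' uIcc x y)

theorem Excursion.bddBelow (e : Excursion) (x y : unitInterval) :
    BddBelow (e.toFun '' uIcc x y) :=
  ⟨0, by rintro _ ⟨z, -, rfl⟩; exact e.nonneg z⟩

theorem Excursion.minOn_le (e : Excursion) {x y z : unitInterval} (hz : z ∈ uIcc x y) :
    e.minOn x y ≤ e.toFun z :=
  csInf_le (e.bddBelow x y) ⟨z, hz, rfl⟩

/-- The minimum is attained. -/
theorem Excursion.exists_eq_minOn (e : Excursion) (x y : unitInterval) :
    ∃ z ∈ uIcc x y, e.toFun z = e.minOn x y := by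
  have hc : IsCompact (uIcc x y) := isCompact_uIcc
  obtain ⟨z, hz, hmin⟩ := hc.exists_isMinOn ⟨x, left_mem_uIcc⟩ e.toFun.continuous.continuousOn
  refine ⟨z, hz, le_antisymm ?_ (e.minOn_le hz)⟩
  refine le_csInf ⟨_, x, left_mem_uIcc, rfl⟩ ?_
  rintro _ ⟨w, hw, rfl⟩
  exact hmin hw

/-- `d_e(x,y) = e(x) + e(y) - 2 min_{[x,y]} e`. -/
def Excursion.dist (e : Excursion) (x y : unitInterval) : ℝ :=
  e.toFun x + e.toFun y - 2 * e.minOn x y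

theorem Excursion.dist_triangle (e : Excursion) (x y z : unitInterval) :
    e.dist x z ≤ e.dist x y + e.dist y z := by
  obtain ⟨w, hw, hwe⟩ := e.exists_eq_minOn x z
  have h1 : e.minOn x y ≤ e.toFun y := e.minOn_le right_mem_uIcc
  have h2 : e.minOn y z ≤ e.toFun y := e.minOn_le left_mem_uIcc
  have h3 : w ∈ uIcc x y ∨ w ∈ uIcc y z := by
    have := uIcc_subset_uIcc_union_uIcc (b := y) hw
    simpa using this
  unfold Excursion.dist
  rcases h3 with h | h
  · have := e.minOn_le h
    linarith
  · have := e.minOn_le h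
    linarith

theorem Excursion.dist_self (e : Excursion) (x : unitInterval) : e.dist x x = 0 := by
  unfold Excursion.dist Excursion.minOn
  rw [uIcc_self, image_singleton, csInf_singleton]
  ring

theorem Excursion.dist_comm (e : Excursion) (x y : unitInterval) : e.dist x y = e.dist y x := by
  unfold Excursion.dist Excursion.minOn
  rw [uIcc_comm]
  ring

/-- The interval `[0,1]`, to be equipped with the pseudometric `d_e`. -/
def TreePoint (_ : Excursion) : Type := unitInterval

instance (e : Excursion) : PseudoMetricSpace (TreePoint e) where
  dist := e.dist
  dist_self := e.dist_self
  dist_comm := e.dist_comm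
  dist_triangle := e.dist_triangle

/-- The real tree of an excursion function: `[0,1]` with the metric `d_e`, points at distance zero
being identified. `SeparationQuotient` carries the induced metric. -/
abbrev Excursion.Tree (e : Excursion) : Type := SeparationQuotient (TreePoint e)

theorem exists_minimizer (f : C(UnitAddCircle, ℝ)) : ∃ a, ∀ x, f a ≤ f x := by
  obtain ⟨a, -, ha⟩ := isCompact_univ.exists_isMinOn ⟨(0 : UnitAddCircle), mem_univ _⟩
    f.continuous.continuousOn
  exact ⟨a, fun x => ha (mem_univ x)⟩

/-- A point of the circle at which `f` is minimal. -/
def argmin (f : C(UnitAddCircle, ℝ)) : UnitAddCircle := (exists_minimizer f).choose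

theorem argmin_le (f : C(UnitAddCircle, ℝ)) (x : UnitAddCircle) : f (argmin f) ≤ f x :=
  (exists_minimizer f).choose_spec x

/-- The excursion function `x ↦ f (x + a) - f a`, `a` a minimiser, of a circle mapping `f`. -/
def excursion (f : C(UnitAddCircle, ℝ)) : Excursion where
  toFun :=
    { toFun := fun x => f (((x : ℝ) : UnitAddCircle) + argmin f) - f (argmin f)
      continuous_toFun := by
        have : Continuous fun x : unitInterval => ((x : ℝ) : UnitAddCircle) :=
          (AddCircle.continuous_mk' (1 : ℝ)).comp continuous_subtype_val
        fun_prop }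
  map_zero := by simp
  map_one := by
    have h : ((1 : ℝ) : UnitAddCircle) = 0 := AddCircle.coe_period 1
    simp [h]
  nonneg x := sub_nonneg.2 (argmin_le f _)

/-- The real tree of a continuous circle mapping. -/
abbrev Tree (f : C(UnitAddCircle, ℝ)) : Type := (excursion f).Tree

/-- The graph `{(x, f(x)) : x ∈ [0,1]}` in the Euclidean plane, where the circle is `[0,1]` with
`0` and `1` identified. -/
def graph (f : C(UnitAddCircle, ℝ)) : Set (EuclideanSpace ℝ (Fin 2)) :=
  (fun x : ℝ => !₂[x, f (x : UnitAddCircle)]) '' Icc 0 1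

/-- The `p`-variation `V^p(f)`: the supremum of `∑ |f(x_i) - f(x_{i+1})|^p` over all finite
sequences `x_0 < x_1 < ... < x_n` in `[0,1]`. -/
def pVariation (p : ℝ) (f : C(UnitAddCircle, ℝ)) : ℝ≥0∞ :=
  ⨆ (n : ℕ) (x : Fin (n + 1) → ℝ) (_ : StrictMono x) (_ : ∀ i, x i ∈ Icc (0 : ℝ) 1),
    ∑ i : Fin n, ENNReal.ofReal
      (|f (x i.castSucc : UnitAddCircle) - f (x i.succ : UnitAddCircle)| ^ p)

/-- The variation index `I(f) = sup {p ≥ 1 | V^p(f) = ∞}`. The supremum is taken in `[1, ∞]`, so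
that it equals `1` if the set is empty. -/
def variationIndex (f : C(UnitAddCircle, ℝ)) : ℝ≥0∞ :=
  1 ⊔ ⨆ (p : ℝ) (_ : 1 ≤ p) (_ : pVariation p f = ⊤), ENNReal.ofReal p

/-- The composition of a circle mapping with a time change. -/
def timeChange (f : C(UnitAddCircle, ℝ)) (τ : UnitAddCircle ≃ₜ UnitAddCircle) :
    C(UnitAddCircle, ℝ) :=
  ⟨fun x => f (τ x), f.continuous.comp τ.continuous⟩

end CircleTree

end

namespace CircleTree

/-! ### Bounds for covering numbers by covers and by separated families. -/

section CoverNumber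

variable {X : Type*} [PseudoMetricSpace X]

/-! Everything is compared with one quantity that no time change affects: the largest number `n(δ)`
of disjoint connected subsets of the circle on which `f` oscillates by at least `δ`
(`HasCrossings`).

If `V^p` is finite, then `n(δ) ≤ C δ^(-p)`. Conversely, `n(δ) ≤ C δ^(-q)` bounds `V^p` for every `p
> q`, by summing over dyadic sizes (`CrossingBound.exists_sum_le`). The tree sees the same count:
tops of crossings are separated in the tree, and neighbouring points of a separated set enclose a
crossing. Hence the tree has dimension `I(f)`; non-constancy is needed only because `I(f)` is at
least 1 by convention.

For the graph, the box count at scale `1/n` is governed by the sum of the oscillations over `n`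
arcs. Hölder bounds that sum by `n^(1-1/p)` times a constant for `p > I(f)`, so the dimension is at
most `2 - 1/I(f)` after any time change.

For sharpness, take `p_k` increasing to `I(f)` and `N_k` disjoint intervals with oscillation `η_k ≥
N_k^(-1/p_k) / 4`. A time change that stretches a gap in front of each to length `ℓ_k = 2^(-k-2) /
N_k` separates the columns of the graph, and each column holds about `η_k / ℓ_k` separated points.
The total `N_k η_k / ℓ_k` has exponent `2 - 1/p_k` up to powers of `2^k`, which are negligible if
`N_k` is huge. The weights `2^(-k-2)` are summable, so one homeomorphism, a mixture of distribution
functions, serves all `k` (`exists_le_upperBoxDim_graph_timeChange`). -/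

theorem coverNumber_le_card {ι : Type*} [Fintype ι] {r : ℝ} (U : ι → Set X)
    (hd : ∀ i, Metric.ediam (U i) ≤ ENNReal.ofReal r) (hU : (⋃ i, U i) = univ) :
    coverNumber X r ≤ (Fintype.card ι : ℕ) := by
  refine iInf₂_le (Fintype.card ι) ⟨fun i => U ((Fintype.equivFin ι).symm i), fun i => hd _, ?_⟩
  rw [← hU]
  exact (Fintype.equivFin ι).symm.surjective.iUnion_comp U

theorem card_le_coverNumber {ι : Type*} [Fintype ι] {r : ℝ} (hr : 0 ≤ r) (x : ι → X)
    (hx : ∀ i j, i ≠ j → r < dist (x i) (x j)) :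
    ((Fintype.card ι : ℕ) : ℕ∞) ≤ coverNumber X r := by
  refine le_iInf₂ fun n hn => ?_
  obtain ⟨U, hd, hU⟩ := hn
  have hmem : ∀ i, ∃ k, x i ∈ U k := fun i => by
    have : x i ∈ ⋃ k, U k := hU ▸ mem_univ _
    simpa using this
  choose k hk using hmem
  have hinj : Function.Injective k := by
    intro i j hij
    by_contra hne
    have h1 : edist (x i) (x j) ≤ ENNReal.ofReal r :=
      (Metric.edist_le_ediam_of_mem (hk i) (hij ▸ hk j)).trans (hd _)
    rw [edist_dist, ENNReal.ofReal_le_ofReal_iff hr] at h1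
    exact absurd h1 (not_le.2 (hx i j hne))
  have := Fintype.card_le_of_injective k hinj
  rw [Fintype.card_fin] at this
  exact_mod_cast this

end CoverNumber

/-! ### Upper box dimension versus power bounds on covering numbers. -/

section UpperBoxDim

theorem log_ofReal_rpow_neg {r : ℝ} (hr : 0 < r) (s : ℝ) :
    ENNReal.log (ENNReal.ofReal (r ^ (-s))) = ((-Real.log r : ℝ) : EReal) * (s : EReal) := by
  rw [ENNReal.log_ofReal_of_pos (Real.rpow_pos_of_pos hr _), Real.log_rpow hr, ← EReal.coe_mul]
  congr 1
  ring

theorem log_div_neg_log_le_iff {r : ℝ} (hr : 0 < r) (hr1 : r < 1) (x : ℝ≥0∞) (s : ℝ) :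
    ENNReal.log x / ((-Real.log r : ℝ) : EReal) ≤ s ↔ x ≤ ENNReal.ofReal (r ^ (-s)) := by
  have hl : 0 < -Real.log r := by linarith [Real.log_neg hr hr1]
  rw [EReal.div_le_iff_le_mul (by exact_mod_cast hl) (EReal.coe_ne_top _),
    ← log_ofReal_rpow_neg hr, ENNReal.log_le_log_iff]

theorem le_log_div_neg_log_iff {r : ℝ} (hr : 0 < r) (hr1 : r < 1) (x : ℝ≥0∞) (s : ℝ) :
    (s : EReal) ≤ ENNReal.log x / ((-Real.log r : ℝ) : EReal) ↔ ENNReal.ofReal (r ^ (-s)) ≤ x := by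
  have hl : 0 < -Real.log r := by linarith [Real.log_neg hr hr1]
  rw [EReal.le_div_iff_mul_le (by exact_mod_cast hl) (EReal.coe_ne_top _), mul_comm,
    ← log_ofReal_rpow_neg hr, ENNReal.log_le_log_iff]

theorem eventually_pos_lt_nhdsGT {c : ℝ} (hc : 0 < c) : ∀ᶠ r : ℝ in 𝓝[>] 0, 0 < r ∧ r < c :=
  Ioo_mem_nhdsGT hc

theorem eventually_const_mul_rpow_neg_le {s s' : ℝ} (h : s < s') (C : ℝ) :
    ∀ᶠ r : ℝ in 𝓝[>] 0, C * r ^ (-s) ≤ r ^ (-s') := by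
  have h1 : Tendsto (fun r : ℝ => C * r ^ (s' - s)) (𝓝[>] 0) (𝓝 (C * 0)) := by
    refine Tendsto.const_mul _ ?_
    have := (Real.continuousAt_rpow_const 0 (s' - s) (Or.inr (by linarith))).tendsto
    rw [Real.zero_rpow (by linarith)] at this
    exact this.mono_left nhdsWithin_le_nhds
  rw [mul_zero] at h1
  filter_upwards [h1.eventually (gt_mem_nhds one_pos), eventually_pos_lt_nhdsGT one_pos]
    with r hr hr0
  have h2 : r ^ (-s) = r ^ (s' - s) * r ^ (-s') := by
    rw [← Real.rpow_add hr0.1]; congr 1; ring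
  rw [h2, ← mul_assoc]
  exact mul_le_of_le_one_left (Real.rpow_nonneg hr0.1.le _) hr.le

variable {X : Type*} [PseudoMetricSpace X]

/-- Any larger exponent `s'` absorbs the constant `C` at small scales; then `s'` decreases to `s`.
-/
theorem upperBoxDim_le_of_eventually {s C : ℝ}
    (h : ∀ᶠ r : ℝ in 𝓝[>] 0, ∃ m : ℕ, coverNumber X r ≤ m ∧ (m : ℝ) ≤ C * r ^ (-s)) :
    upperBoxDim X ≤ ENNReal.ofReal s := by
  have key : ∀ s' > s, upperBoxDim X ≤ ENNReal.ofReal s' := by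
    intro s' hs'
    refine limsup_le_of_le (by isBoundedDefault) ?_
    filter_upwards [h, eventually_const_mul_rpow_neg_le hs' C, eventually_pos_lt_nhdsGT one_pos]
      with r ⟨m, hm, hmC⟩ h2 hr
    rw [← EReal.real_coe_toENNReal]
    refine EReal.toENNReal_le_toENNReal ?_
    rw [log_div_neg_log_le_iff hr.1 hr.2]
    calc (coverNumber X r : ℝ≥0∞) ≤ ((m : ℕ∞) : ℝ≥0∞) := by exact_mod_cast hm
      _ = ENNReal.ofReal m := by simp
      _ ≤ _ := ENNReal.ofReal_le_ofReal (hmC.trans h2)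
  have h3 : Tendsto (fun s' : ℝ => ENNReal.ofReal s') (𝓝[>] s) (𝓝 (ENNReal.ofReal s)) :=
    (ENNReal.continuous_ofReal.tendsto s).mono_left nhdsWithin_le_nhds
  exact ge_of_tendsto h3 (eventually_mem_nhdsWithin.mono key)

theorem le_upperBoxDim_of_frequently {s : ℝ}
    (h : ∃ᶠ r : ℝ in 𝓝[>] 0, ∃ m : ℕ, (m : ℕ∞) ≤ coverNumber X r ∧ r ^ (-s) ≤ (m : ℝ)) :
    ENNReal.ofReal s ≤ upperBoxDim X := by
  refine le_limsup_of_frequently_le ?_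
  refine (h.and_eventually (eventually_pos_lt_nhdsGT one_pos)).mono ?_
  rintro r ⟨⟨m, hm, hms⟩, hr⟩
  rw [← EReal.real_coe_toENNReal]
  refine EReal.toENNReal_le_toENNReal ?_
  rw [le_log_div_neg_log_iff hr.1 hr.2]
  calc ENNReal.ofReal (r ^ (-s)) ≤ ENNReal.ofReal m := ENNReal.ofReal_le_ofReal hms
    _ = ((m : ℕ∞) : ℝ≥0∞) := by simp
    _ ≤ _ := by exact_mod_cast hm

theorem eventually_coverNumber_le_of_upperBoxDim_lt {s : ℝ}
    (h : upperBoxDim X < ENNReal.ofReal s) :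
    ∀ᶠ r : ℝ in 𝓝[>] 0, ∃ m : ℕ, coverNumber X r ≤ m ∧ (m : ℝ) ≤ r ^ (-s) := by
  have hs : 0 < s := by
    by_contra hs
    rw [ENNReal.ofReal_of_nonpos (not_lt.1 hs)] at h
    exact not_lt_bot h
  filter_upwards [eventually_lt_of_limsup_lt h, eventually_pos_lt_nhdsGT one_pos] with r h1 hr
  have h2 : (coverNumber X r : ℝ≥0∞) ≤ ENNReal.ofReal (r ^ (-s)) := by
    rw [← log_div_neg_log_le_iff hr.1 hr.2]
    by_contra hcon
    have := EReal.toENNReal_le_toENNReal (not_le.1 hcon).le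
    rw [EReal.real_coe_toENNReal] at this
    exact absurd h1 (not_lt.2 this)
  have hne : coverNumber X r ≠ ⊤ := by
    intro htop
    rw [htop] at h2
    exact ENNReal.ofReal_ne_top (top_le_iff.1 h2)
  obtain ⟨m, hm⟩ := ENat.ne_top_iff_exists.1 hne
  refine ⟨m, hm.ge, ?_⟩
  rw [← hm] at h2
  have h3 : ENNReal.ofReal (m : ℝ) ≤ ENNReal.ofReal (r ^ (-s)) := by simpa using h2
  exact (ENNReal.ofReal_le_ofReal_iff (Real.rpow_nonneg hr.1.le _)).1 h3

/-- A space with a `1`-Lipschitz function whose range contains a nondegenerate interval has upper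
box dimension at least one. -/
theorem one_le_upperBoxDim (φ : X → ℝ) (hφ : ∀ x y, |φ x - φ y| ≤ dist x y) {a b : ℝ}
    (hab : a < b) (hr : Icc a b ⊆ range φ) : 1 ≤ upperBoxDim X := by
  have key : ∀ s : ℝ, s < 1 → ENNReal.ofReal s ≤ upperBoxDim X := by
    intro s hs
    refine le_upperBoxDim_of_frequently (Eventually.frequently ?_)
    filter_upwards [eventually_const_mul_rpow_neg_le hs (2 / (b - a)),
      eventually_pos_lt_nhdsGT one_pos] with r h1 hr0
    have hba : 0 < b - a := by linarith
    -- Spacing `2 * r` makes the `m + 1` points strictly more than `r` apart.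
    set m := ⌊(b - a) / (2 * r)⌋₊ with hm
    have hmle : (m : ℝ) * (2 * r) ≤ b - a := by
      have := Nat.floor_le (a := (b - a) / (2 * r)) (by have := hr0.1; positivity)
      rwa [le_div_iff₀ (by linarith)] at this
    have hmem : ∀ j : Fin (m + 1), ∃ x, φ x = a + j * (2 * r) := by
      intro j
      have hj : ((j : ℕ) : ℝ) ≤ m := by exact_mod_cast Nat.lt_succ_iff.1 j.2
      have h2 : (j : ℝ) * (2 * r) ≤ m * (2 * r) := by
        apply mul_le_mul_of_nonneg_right hj; linarith [hr0.1]
      have h3 : 0 ≤ (j : ℝ) * (2 * r) := mul_nonneg (Nat.cast_nonneg _) (by linarith [hr0.1])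
      exact hr ⟨by linarith, by linarith⟩
    choose x hx using hmem
    refine ⟨m + 1, ?_, ?_⟩
    · have := card_le_coverNumber hr0.1.le x ?_
      · simpa using this
      · intro i j hij
        refine lt_of_lt_of_le ?_ (hφ _ _)
        rw [hx, hx, show a + (i : ℝ) * (2 * r) - (a + j * (2 * r)) = ((i : ℝ) - j) * (2 * r) by ring,
          abs_mul, abs_of_pos (by linarith [hr0.1] : 0 < 2 * r)]
        have h4 : (1 : ℝ) ≤ |(i : ℝ) - j| := by
          have h5 : (1 : ℤ) ≤ |((i : ℕ) : ℤ) - ((j : ℕ) : ℤ)| := by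
            apply Int.one_le_abs
            rw [sub_ne_zero]
            exact_mod_cast fun h => hij (Fin.ext h)
          exact_mod_cast h5
        nlinarith [hr0.1]
    · have h6 : (b - a) / (2 * r) < m + 1 := Nat.lt_floor_add_one _
      have h7 : (2 / (b - a)) * r ^ (-s) ≤ r⁻¹ := by simpa [Real.rpow_neg_one] using h1
      have h8 : r ^ (-s) ≤ (b - a) / (2 * r) := by
        have := mul_le_mul_of_nonneg_left h7 (by positivity : 0 ≤ (b - a) / 2)
        calc r ^ (-s) = (b - a) / 2 * (2 / (b - a) * r ^ (-s)) := by field_simp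
          _ ≤ (b - a) / 2 * r⁻¹ := this
          _ = _ := by have := hr0.1; field_simp
      push_cast
      linarith
  have h3 : Tendsto (fun s' : ℝ => ENNReal.ofReal s') (𝓝[<] 1) (𝓝 (ENNReal.ofReal 1)) :=
    (ENNReal.continuous_ofReal.tendsto 1).mono_left nhdsWithin_le_nhds
  rw [← ENNReal.ofReal_one]
  exact le_of_tendsto h3 (eventually_mem_nhdsWithin.mono key)

end UpperBoxDim

/-! ### Crossing numbers, their invariance under time change, and `p`-variation. -/

section Crossings

/-- There are `n` pairwise disjoint connected subsets of the circle on each of which `f` oscillates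
by at least `δ`. -/
def HasCrossings (f : C(UnitAddCircle, ℝ)) (δ : ℝ) (n : ℕ) : Prop :=
  ∃ A : Fin n → Set UnitAddCircle, (∀ i, IsPreconnected (A i)) ∧
    (∀ i j, i ≠ j → Disjoint (A i) (A j)) ∧ ∀ i, ∃ a ∈ A i, ∃ b ∈ A i, δ ≤ |f a - f b|

/-- The number of disjoint oscillations of size `δ ≤ 1` is at most `C * δ ^ (-q)`. -/
def CrossingBound (f : C(UnitAddCircle, ℝ)) (q C : ℝ) : Prop :=
  ∀ δ : ℝ, 0 < δ → δ ≤ 1 → ∀ n : ℕ, HasCrossings f δ n → (n : ℝ) ≤ C * δ ^ (-q)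

variable {f : C(UnitAddCircle, ℝ)}

theorem hasCrossings_card {ι : Type*} [Fintype ι] {δ : ℝ} (A : ι → Set UnitAddCircle)
    (hA : ∀ i, IsPreconnected (A i)) (hd : ∀ i j, i ≠ j → Disjoint (A i) (A j))
    (h : ∀ i, ∃ a ∈ A i, ∃ b ∈ A i, δ ≤ |f a - f b|) : HasCrossings f δ (Fintype.card ι) :=
  ⟨fun i => A ((Fintype.equivFin ι).symm i), fun _ => hA _,
    fun _ _ hij => hd _ _ fun h' => hij ((Fintype.equivFin ι).symm.injective h'), fun _ => h _⟩

theorem HasCrossings.mono {δ δ' : ℝ} {n : ℕ} (h : HasCrossings f δ n) (hδ : δ' ≤ δ) :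
    HasCrossings f δ' n := by
  obtain ⟨A, h1, h2, h3⟩ := h
  refine ⟨A, h1, h2, fun i => ?_⟩
  obtain ⟨a, ha, b, hb, hab⟩ := h3 i
  exact ⟨a, ha, b, hb, hδ.trans hab⟩

/-- Connectedness and disjointness are topological, which is why crossings live on connected sets of
the circle. -/
theorem HasCrossings.timeChange {δ : ℝ} {n : ℕ} (h : HasCrossings f δ n)
    (τ : UnitAddCircle ≃ₜ UnitAddCircle) : HasCrossings (timeChange f τ) δ n := by
  obtain ⟨A, h1, h2, h3⟩ := h
  refine ⟨fun i => τ.symm '' A i, fun i => (h1 i).image _ τ.symm.continuous.continuousOn,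
    fun i j hij => (disjoint_image_iff τ.symm.injective).2 (h2 i j hij), fun i => ?_⟩
  obtain ⟨a, ha, b, hb, hab⟩ := h3 i
  exact ⟨_, mem_image_of_mem _ ha, _, mem_image_of_mem _ hb, by simpa [CircleTree.timeChange]⟩

theorem hasCrossings_timeChange_iff {δ : ℝ} {n : ℕ} (τ : UnitAddCircle ≃ₜ UnitAddCircle) :
    HasCrossings (timeChange f τ) δ n ↔ HasCrossings f δ n := by
  refine ⟨fun h => ?_, fun h => h.timeChange τ⟩
  have h2 : timeChange (timeChange f τ) τ.symm = f := by
    ext x; simp [timeChange]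
  simpa [h2] using h.timeChange τ.symm

theorem CrossingBound.timeChange {q C : ℝ} (h : CrossingBound f q C)
    (τ : UnitAddCircle ≃ₜ UnitAddCircle) : CrossingBound (timeChange f τ) q C :=
  fun δ h0 h1 n hn => h δ h0 h1 n ((hasCrossings_timeChange_iff τ).1 hn)

/-- Crossing counts decrease in `δ`, so the bound at one small `ε` controls all `δ` in `[ε, 1]`. -/
theorem exists_crossingBound_of_eventually {q C : ℝ} (hq : 0 ≤ q)
    (h : ∀ᶠ δ : ℝ in 𝓝[>] 0, ∀ n : ℕ, HasCrossings f δ n → (n : ℝ) ≤ C * δ ^ (-q)) :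
    ∃ C', CrossingBound f q C' := by
  obtain ⟨ε, hε, hsub⟩ := mem_nhdsGT_iff_exists_Ioc_subset.1 h
  have hε0 : (0 : ℝ) < ε := hε
  refine ⟨max C (C * ε ^ (-q)), fun δ h0 h1 n hn => ?_⟩
  have hpos : 0 ≤ δ ^ (-q) := Real.rpow_nonneg h0.le _
  rcases le_total δ ε with hle | hle
  · exact (hsub ⟨h0, hle⟩ n hn).trans (mul_le_mul_of_nonneg_right (le_max_left _ _) hpos)
  · have h2 := hsub ⟨hε0, le_rfl⟩ n (hn.mono hle)
    have h3 : 1 ≤ δ ^ (-q) := Real.one_le_rpow_of_pos_of_le_one_of_nonpos h0 h1 (by linarith)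
    have h4 : 0 ≤ max C (C * ε ^ (-q)) := (Nat.cast_nonneg n).trans (h2.trans (le_max_right _ _))
    calc (n : ℝ) ≤ max C (C * ε ^ (-q)) := h2.trans (le_max_right _ _)
      _ ≤ _ := le_mul_of_one_le_right h4 h3

theorem exists_forall_abs_sub_le (f : C(UnitAddCircle, ℝ)) : ∃ M, ∀ x y, |f x - f y| ≤ M :=
  ⟨‖f‖ + ‖f‖, fun x y => (abs_sub _ _).trans (add_le_add (f.norm_coe_le_norm x)
    (f.norm_coe_le_norm y))⟩

/-- A single dyadic level just below `Δ` already dominates (level 0 if `Δ ≥ 1`). Written with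
thresholds, a `p`-variation sum becomes a sum of crossing counts. -/
theorem ofReal_rpow_le_tsum {p M B Δ : ℝ} (hp : 0 < p) (h0 : 0 ≤ Δ) (hM : Δ ≤ M)
    (hB1 : 2 ^ p ≤ B) (hB2 : M ^ p ≤ B) :
    ENNReal.ofReal (Δ ^ p) ≤
      ∑' k : ℕ, if (1 / 2 : ℝ) ^ k ≤ Δ then ENNReal.ofReal (B * ((1 / 2 : ℝ) ^ k) ^ p) else 0 := by
  have key : ∀ k : ℕ, (1 / 2 : ℝ) ^ k ≤ Δ → Δ ^ p ≤ B * ((1 / 2 : ℝ) ^ k) ^ p →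
      ENNReal.ofReal (Δ ^ p) ≤ ∑' k : ℕ,
        if (1 / 2 : ℝ) ^ k ≤ Δ then ENNReal.ofReal (B * ((1 / 2 : ℝ) ^ k) ^ p) else 0 := by
    intro k hk hk2
    refine le_trans ?_ (ENNReal.le_tsum k)
    rw [if_pos hk]
    exact ENNReal.ofReal_le_ofReal hk2
  rcases h0.eq_or_lt with h | h
  · rw [← h, Real.zero_rpow hp.ne', ENNReal.ofReal_zero]
    exact zero_le
  rcases le_total 1 Δ with h1 | h1
  · refine key 0 (by simpa) ?_
    simpa using (Real.rpow_le_rpow h0 hM hp.le).trans hB2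
  · obtain ⟨k, hk1, hk2⟩ := exists_nat_pow_near_of_lt_one h h1 (by norm_num : (0 : ℝ) < 1 / 2)
      (by norm_num)
    refine key (k + 1) hk1.le ?_
    calc Δ ^ p ≤ ((1 / 2 : ℝ) ^ k) ^ p := Real.rpow_le_rpow h0 hk2 hp.le
      _ = 2 ^ p * ((1 / 2 : ℝ) ^ (k + 1)) ^ p := by
          rw [← Real.mul_rpow (by norm_num) (by positivity)]; congr 1; ring
      _ ≤ _ := mul_le_mul_of_nonneg_right hB1 (by positivity)

/-- A polynomial bound on the number of oscillations bounds all `p`-variation sums over disjoint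
connected sets, for every larger exponent `p`. -/
theorem CrossingBound.exists_sum_le {q C p : ℝ} (h : CrossingBound f q C) (hq : 0 < q)
    (hqp : q < p) : ∃ K : ℝ≥0∞, K ≠ ⊤ ∧ ∀ (n : ℕ) (A : Fin n → Set UnitAddCircle)
      (a b : Fin n → UnitAddCircle), (∀ i, IsPreconnected (A i)) →
      (∀ i j, i ≠ j → Disjoint (A i) (A j)) → (∀ i, a i ∈ A i) → (∀ i, b i ∈ A i) →
      ∑ i, ENNReal.ofReal (|f (a i) - f (b i)| ^ p) ≤ K := by
  obtain ⟨M, hM⟩ := exists_forall_abs_sub_le f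
  set B : ℝ := max (2 ^ p) (M ^ p) with hB
  have hB0 : 0 ≤ B := (by positivity : (0 : ℝ) ≤ 2 ^ p).trans (le_max_left _ _)
  -- Level `k` has at most `C 2^(kq)` crossings of weight `B 2^(-kp)`: a geometric series of ratio
  -- `2^(-(p-q))`.
  refine ⟨∑' k : ℕ, ENNReal.ofReal (B * C * ((1 / 2 : ℝ) ^ (p - q)) ^ k), ?_, ?_⟩
  · refine Summable.tsum_ofReal_ne_top (Summable.mul_left _ ?_)
    exact summable_geometric_of_lt_one (by positivity)
      (Real.rpow_lt_one (by norm_num) (by norm_num) (by linarith))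
  intro n A a b hA hd ha hb
  calc ∑ i, ENNReal.ofReal (|f (a i) - f (b i)| ^ p)
      ≤ ∑ i, ∑' k : ℕ, (if (1 / 2 : ℝ) ^ k ≤ |f (a i) - f (b i)| then
          ENNReal.ofReal (B * ((1 / 2 : ℝ) ^ k) ^ p) else 0) :=
        Finset.sum_le_sum fun i _ => ofReal_rpow_le_tsum (by linarith) (abs_nonneg _) (hM _ _)
          (le_max_left _ _) (le_max_right _ _)
    _ = ∑' k : ℕ, ∑ i, (if (1 / 2 : ℝ) ^ k ≤ |f (a i) - f (b i)| then
          ENNReal.ofReal (B * ((1 / 2 : ℝ) ^ k) ^ p) else 0) :=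
        (Summable.tsum_finsetSum fun _ _ => ENNReal.summable).symm
    _ ≤ _ := by
      refine ENNReal.tsum_le_tsum fun k => ?_
      rw [← Finset.sum_filter, Finset.sum_const, nsmul_eq_mul, ← ENNReal.ofReal_natCast,
        ← ENNReal.ofReal_mul (Nat.cast_nonneg _)]
      refine ENNReal.ofReal_le_ofReal ?_
      have hcr := hasCrossings_card (f := f) (δ := (1 / 2 : ℝ) ^ k)
        (fun i : {i : Fin n // (1 / 2 : ℝ) ^ k ≤ |f (a i) - f (b i)|} => A i) (fun i => hA _)
        (fun i j hij => hd _ _ fun h' => hij (Subtype.ext h'))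
        (fun i => ⟨a i, ha _, b i, hb _, i.2⟩)
      have hk0 : (0 : ℝ) < (1 / 2 : ℝ) ^ k := by positivity
      have hcard := h _ hk0 (pow_le_one₀ (by norm_num) (by norm_num)) _ hcr
      rw [Fintype.card_subtype] at hcard
      calc _ ≤ C * ((1 / 2 : ℝ) ^ k) ^ (-q) * (B * ((1 / 2 : ℝ) ^ k) ^ p) :=
            mul_le_mul_of_nonneg_right hcard (by positivity)
        _ = B * C * (((1 / 2 : ℝ) ^ k) ^ (-q) * ((1 / 2 : ℝ) ^ k) ^ p) := by ring
        _ = _ := by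
            rw [← Real.rpow_add hk0, ← Real.rpow_natCast, ← Real.rpow_natCast,
              ← Real.rpow_mul (by norm_num), ← Real.rpow_mul (by norm_num)]
            ring_nf

theorem exists_coe_eq (y : UnitAddCircle) : ∃ x ∈ Ico (0 : ℝ) 1, (x : UnitAddCircle) = y := by
  have h : y ∈ ((↑) : ℝ → UnitAddCircle) '' Ico 0 (0 + 1) := by
    rw [AddCircle.coe_image_Ico_eq]; exact mem_univ _
  simpa using h

theorem coe_inj_of_mem_Ico {x y : ℝ} (hx : x ∈ Ico (0 : ℝ) 1) (hy : y ∈ Ico (0 : ℝ) 1)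
    (h : (x : UnitAddCircle) = y) : x = y :=
  (AddCircle.coe_eq_coe_iff_of_mem_Ico (p := (1 : ℝ)) (a := 0) (by simpa using hx)
    (by simpa using hy)).1 h

theorem disjoint_image_coe {S T : Set ℝ} (hS : S ⊆ Ico 0 1) (hT : T ⊆ Ico 0 1)
    (h : Disjoint S T) : Disjoint ((fun x : ℝ => (x : UnitAddCircle)) '' S)
      ((fun x : ℝ => (x : UnitAddCircle)) '' T) := by
  rw [disjoint_left]
  rintro _ ⟨x, hx, rfl⟩ ⟨y, hy, hxy⟩
  have : y = x := coe_inj_of_mem_Ico (hT hy) (hS hx) hxy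
  exact disjoint_left.1 h hx (this ▸ hy)

theorem isPreconnected_image_coe {S : Set ℝ} (hS : IsPreconnected S) :
    IsPreconnected ((fun x : ℝ => (x : UnitAddCircle)) '' S) :=
  hS.image _ (AddCircle.continuous_mk' (1 : ℝ)).continuousOn

theorem continuous_comp_coe (f : C(UnitAddCircle, ℝ)) :
    Continuous fun x : ℝ => f (x : UnitAddCircle) :=
  f.continuous.comp (AddCircle.continuous_mk' (1 : ℝ))

/-- Move both end points slightly inwards. This makes adjacent intervals, which share an end point,
disjoint at the cost of a factor 2. -/
theorem exists_mem_Ioo_half_le {g : ℝ → ℝ} (hg : Continuous g) {u v : ℝ} (huv : u < v) :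
    ∃ a ∈ Ioo u v, ∃ b ∈ Ioo u v, |g u - g v| / 2 ≤ |g a - g b| := by
  rcases eq_or_ne (g u) (g v) with h | h
  · refine ⟨(u + v) / 2, ⟨by linarith, by linarith⟩, (u + v) / 2, ⟨by linarith, by linarith⟩, ?_⟩
    simp [h]
  · have hpos : 0 < |g u - g v| := abs_pos.2 (sub_ne_zero.2 h)
    have hc : Continuous fun t : ℝ => |g (u + t) - g (v - t)| := by fun_prop
    have ht : Tendsto (fun t : ℝ => |g (u + t) - g (v - t)|) (𝓝[>] 0) (𝓝 |g u - g v|) := by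
      simpa using (hc.tendsto 0).mono_left nhdsWithin_le_nhds
    obtain ⟨t, ht1, ht2⟩ := ((ht.eventually (lt_mem_nhds (half_lt_self hpos))).and
      (eventually_pos_lt_nhdsGT (sub_pos.2 huv))).exists
    exact ⟨u + t, ⟨by linarith, by linarith⟩, v - t, ⟨by linarith, by linarith⟩, ht1.le⟩

theorem CrossingBound.pVariation_ne_top {q C p : ℝ} (h : CrossingBound f q C) (hq : 0 < q)
    (hqp : q < p) : pVariation p f ≠ ⊤ := by
  obtain ⟨K, hK, hsum⟩ := h.exists_sum_le hq hqp
  -- The factor `2 ^ p` pays for passing to open intervals.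
  refine ne_top_of_le_ne_top (ENNReal.mul_ne_top (ENNReal.ofReal_ne_top (r := 2 ^ p)) hK) ?_
  refine iSup_le fun n => iSup_le fun x => iSup_le fun hx => iSup_le fun hmem => ?_
  have hex : ∀ i : Fin n, ∃ a ∈ Ioo (x i.castSucc) (x i.succ), ∃ b ∈ Ioo (x i.castSucc) (x i.succ),
      |f (x i.castSucc : UnitAddCircle) - f (x i.succ : UnitAddCircle)| / 2 ≤
        |f (a : UnitAddCircle) - f (b : UnitAddCircle)| := fun i =>
    exists_mem_Ioo_half_le (continuous_comp_coe f) (hx Fin.castSucc_lt_succ)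
  choose a ha b hb hab using hex
  have hsub : ∀ i : Fin n, Ioo (x i.castSucc) (x i.succ) ⊆ Ico 0 1 := fun i y hy =>
    ⟨(hmem _).1.trans hy.1.le, hy.2.trans_le (hmem _).2⟩
  have hlt : ∀ i j : Fin n, i < j → Disjoint (Ioo (x i.castSucc) (x i.succ))
      (Ioo (x j.castSucc) (x j.succ)) := fun i j hij => by
    have h1 : x i.succ ≤ x j.castSucc := hx.monotone (Fin.succ_le_castSucc_iff.2 hij)
    rw [disjoint_left]
    intro y hy hy'
    linarith [hy.2, hy'.1]
  have := hsum n (fun i => (fun x : ℝ => (x : UnitAddCircle)) '' Ioo (x i.castSucc) (x i.succ))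
    (fun i => (a i : UnitAddCircle)) (fun i => (b i : UnitAddCircle))
    (fun i => isPreconnected_image_coe isPreconnected_Ioo)
    (fun i j hij => disjoint_image_coe (hsub i) (hsub j) (by
      rcases lt_or_gt_of_ne hij with h' | h'
      · exact hlt i j h'
      · exact (hlt j i h').symm))
    (fun i => ⟨_, ha i, rfl⟩) (fun i => ⟨_, hb i, rfl⟩)
  refine le_trans ?_ (mul_le_mul_right this _)
  rw [Finset.mul_sum]
  refine Finset.sum_le_sum fun i _ => ?_
  rw [← ENNReal.ofReal_mul (by positivity), ← Real.mul_rpow (by norm_num) (abs_nonneg _)]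
  refine ENNReal.ofReal_le_ofReal (Real.rpow_le_rpow (abs_nonneg _) ?_ (by linarith))
  linarith [hab i]

/-- All but at most one of the oscillations take place on intervals in `(0,1)`. -/
theorem HasCrossings.exists_intervals {δ : ℝ} (hδ : 0 < δ) {n : ℕ} (h : HasCrossings f δ n) :
    ∃ (s : Finset (Fin n)) (u v : Fin n → ℝ), n ≤ s.card + 1 ∧
      (∀ i ∈ s, 0 < u i ∧ u i < v i ∧ v i < 1 ∧
        δ ≤ |f (u i : UnitAddCircle) - f (v i : UnitAddCircle)|) ∧
      ∀ i ∈ s, ∀ j ∈ s, i ≠ j → Disjoint (Icc (u i) (v i)) (Icc (u j) (v j)) := by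
  classical
  obtain ⟨A, hA, hd, hab⟩ := h
  set e := AddCircle.openPartialHomeomorphCoe (1 : ℝ) 0
  have hsrc : e.source = Ioo 0 1 := by simp [e, AddCircle.openPartialHomeomorphCoe]
  have htgt : e.target = {0}ᶜ := by simp [e, AddCircle.openPartialHomeomorphCoe]
  have hcoe : ∀ x : ℝ, e x = (x : UnitAddCircle) := fun x => rfl
  have key : ∀ i : Fin n, ∃ u v : ℝ, (0 : UnitAddCircle) ∉ A i → 0 < u ∧ u < v ∧ v < 1 ∧
      δ ≤ |f (u : UnitAddCircle) - f (v : UnitAddCircle)| ∧ ∀ x ∈ Icc u v, ↑x ∈ A i ∧ x ∈ Ioo 0 1 := by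
    intro i
    by_cases h0 : (0 : UnitAddCircle) ∈ A i
    -- Dummy values for the set through `0`, which is discarded; disjointness allows at most one
    -- such set.
    · exact ⟨0, 0, fun h => absurd h0 h⟩
    have hsub : A i ⊆ e.target := by
      rw [htgt]; intro x hx hx0; exact h0 (by rw [← (hx0 : x = 0)]; exact hx)
    -- In the chart of the circle minus `0` the set becomes order-connected, so it contains the
    -- whole interval between its two oscillation points.
    have hpre : IsPreconnected (e.symm '' A i) :=
      (hA i).image _ (e.continuousOn_symm.mono hsub)
    have hord := hpre.ordConnected
    obtain ⟨a, ha, b, hb, hfab⟩ := hab i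
    have hin : ∀ x ∈ e.symm '' A i, ↑x ∈ A i ∧ x ∈ Ioo (0 : ℝ) 1 := by
      rintro _ ⟨y, hy, rfl⟩
      refine ⟨?_, ?_⟩
      · rw [← hcoe, e.right_inv (hsub hy)]; exact hy
      · rw [← hsrc]; exact e.map_target (hsub hy)
    have hea : ((e.symm a : ℝ) : UnitAddCircle) = a := by rw [← hcoe, e.right_inv (hsub ha)]
    have heb : ((e.symm b : ℝ) : UnitAddCircle) = b := by rw [← hcoe, e.right_inv (hsub hb)]
    have hma : e.symm a ∈ e.symm '' A i := ⟨a, ha, rfl⟩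
    have hmb : e.symm b ∈ e.symm '' A i := ⟨b, hb, rfl⟩
    rcases lt_trichotomy (e.symm a) (e.symm b) with hlt | heq | hlt
    · refine ⟨e.symm a, e.symm b, fun _ => ⟨(hin _ hma).2.1, hlt, (hin _ hmb).2.2, ?_,
        fun x hx => hin x (hord.out hma hmb hx)⟩⟩
      rwa [hea, heb]
    · exfalso
      have : a = b := by rw [← hea, ← heb, heq]
      rw [this, sub_self, abs_zero] at hfab
      linarith
    · refine ⟨e.symm b, e.symm a, fun _ => ⟨(hin _ hmb).2.1, hlt, (hin _ hma).2.2, ?_,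
        fun x hx => hin x (hord.out hmb hma hx)⟩⟩
      rwa [hea, heb, abs_sub_comm]
  choose u v huv using key
  refine ⟨Finset.univ.filter fun i => (0 : UnitAddCircle) ∉ A i, u, v, ?_, ?_, ?_⟩
  · have h1 : (Finset.univ.filter fun i => (0 : UnitAddCircle) ∈ A i).card ≤ 1 := by
      rw [Finset.card_le_one]
      intro i hi j hj
      by_contra hij
      exact disjoint_left.1 (hd i j hij) (Finset.mem_filter.1 hi).2 (Finset.mem_filter.1 hj).2
    have h2 := Finset.card_filter_add_card_filter_not (s := (Finset.univ : Finset (Fin n)))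
      (fun i => (0 : UnitAddCircle) ∈ A i)
    rw [Finset.card_univ, Fintype.card_fin] at h2
    omega
  · intro i hi
    obtain ⟨h1, h2, h3, h4, -⟩ := huv i (Finset.mem_filter.1 hi).2
    exact ⟨h1, h2, h3, h4⟩
  · intro i hi j hj hij
    obtain ⟨-, -, -, -, h5⟩ := huv i (Finset.mem_filter.1 hi).2
    obtain ⟨-, -, -, -, h5'⟩ := huv j (Finset.mem_filter.1 hj).2
    rw [disjoint_left]
    intro x hx hx'
    exact disjoint_left.1 (hd i j hij) (h5 x hx).1 (h5' x hx').1

theorem sum_le_pVariation_of_strictMono (p : ℝ) {m : ℕ} {x : Fin (m + 1) → ℝ} (hx : StrictMono x)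
    (hmem : ∀ i, x i ∈ Icc (0 : ℝ) 1) :
    ∑ i : Fin m, ENNReal.ofReal
      (|f (x i.castSucc : UnitAddCircle) - f (x i.succ : UnitAddCircle)| ^ p) ≤ pVariation p f :=
  le_iSup_of_le m <| le_iSup_of_le x <| le_iSup_of_le hx <| le_iSup_of_le hmem le_rfl

/-- The endpoints of disjoint intervals, listed in increasing order: the two endpoints of an
interval are neighbours in the list. -/
theorem exists_strictMono_endpoints {ι : Type*} (s : Finset ι) (hs : s.Nonempty) (u v : ι → ℝ)
    (h : ∀ i ∈ s, u i < v i)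
    (hd : ∀ i ∈ s, ∀ j ∈ s, i ≠ j → Disjoint (Icc (u i) (v i)) (Icc (u j) (v j))) :
    ∃ (m : ℕ) (e : Fin (m + 1) → ℝ), StrictMono e ∧ (∀ j, ∃ l ∈ s, e j = u l ∨ e j = v l) ∧
      ∀ i ∈ s, ∃ j : Fin m, e j.castSucc = u i ∧ e j.succ = v i := by
  classical
  obtain ⟨i₀, hi₀⟩ := hs
  obtain ⟨S, hS⟩ : ∃ S : Finset ℝ, S = s.image u ∪ s.image v := ⟨_, rfl⟩
  have huS : ∀ i ∈ s, u i ∈ S := fun i hi =>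
    hS ▸ Finset.mem_union_left _ (Finset.mem_image_of_mem _ hi)
  have hvS : ∀ i ∈ s, v i ∈ S := fun i hi =>
    hS ▸ Finset.mem_union_right _ (Finset.mem_image_of_mem _ hi)
  obtain ⟨m, hm⟩ : ∃ m, S.card = m + 1 :=
    Nat.exists_eq_succ_of_ne_zero (Finset.card_ne_zero_of_mem (huS i₀ hi₀))
  obtain ⟨e, he, her⟩ : ∃ e : Fin (m + 1) → ℝ, StrictMono e ∧ range e = S :=
    ⟨S.orderEmbOfFin hm, (S.orderEmbOfFin hm).strictMono, Finset.range_orderEmbOfFin _ _⟩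
  have hsurj : ∀ y ∈ S, ∃ j, e j = y := by
    intro y hy
    have : y ∈ range e := by rw [her]; exact hy
    exact this
  have hcases : ∀ j, ∃ l ∈ s, e j = u l ∨ e j = v l := by
    intro j
    have hj : e j ∈ S := by rw [← Finset.mem_coe, ← her]; exact mem_range_self j
    rw [hS] at hj
    rcases Finset.mem_union.1 hj with h' | h' <;> obtain ⟨l, hl, hl'⟩ := Finset.mem_image.1 h'
    · exact ⟨l, hl, Or.inl hl'.symm⟩
    · exact ⟨l, hl, Or.inr hl'.symm⟩
  refine ⟨m, e, he, hcases, fun i hi => ?_⟩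
  obtain ⟨j, hj⟩ := hsurj _ (huS i hi)
  obtain ⟨k, hk⟩ := hsurj _ (hvS i hi)
  have hjk : j < k := by
    rw [← he.lt_iff_lt, hj, hk]; exact h i hi
  obtain ⟨j', rfl⟩ := Fin.exists_castSucc_eq.2 (ne_of_lt (hjk.trans_le (Fin.le_last k)))
  refine ⟨j', hj, ?_⟩
  have hle : j'.succ ≤ k := Fin.castSucc_lt_iff_succ_le.1 hjk
  rcases hle.eq_or_lt with heq | hlt
  · rw [heq, hk]
  -- Otherwise an end point of some other interval would lie strictly between `u i` and `v i`,
  -- against disjointness.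
  exfalso
  have h1 : u i < e j'.succ := by
    rw [← hj]; exact he Fin.castSucc_lt_succ
  have h2 : e j'.succ < v i := by
    rw [← hk]; exact he hlt
  obtain ⟨l, hl, hl'⟩ := hcases j'.succ
  have hil : i ≠ l := by
    rintro rfl
    rcases hl' with hl' | hl'
    · exact h1.ne' hl'
    · exact h2.ne hl'
  have h3 : e j'.succ ∈ Icc (u l) (v l) := by
    have := h l hl
    rcases hl' with hl' | hl' <;> rw [hl']
    · exact ⟨le_rfl, this.le⟩
    · exact ⟨this.le, le_rfl⟩
  exact disjoint_left.1 (hd i hi l hl hil) ⟨h1.le, h2.le⟩ h3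

/-- The increments over the intervals are distinct consecutive increments of the sorted end points;
those over the gaps are dropped. -/
theorem sum_le_pVariation (p : ℝ) {ι : Type*} (s : Finset ι) (u v : ι → ℝ)
    (h : ∀ i ∈ s, 0 ≤ u i ∧ u i < v i ∧ v i ≤ 1)
    (hd : ∀ i ∈ s, ∀ j ∈ s, i ≠ j → Disjoint (Icc (u i) (v i)) (Icc (u j) (v j))) :
    ∑ i ∈ s, ENNReal.ofReal (|f (u i : UnitAddCircle) - f (v i : UnitAddCircle)| ^ p) ≤
      pVariation p f := by
  classical
  rcases s.eq_empty_or_nonempty with rfl | hs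
  · simp
  obtain ⟨m, e, he, hcases, hadj⟩ :=
    exists_strictMono_endpoints s hs u v (fun i hi => (h i hi).2.1) hd
  have hmem : ∀ j, e j ∈ Icc (0 : ℝ) 1 := by
    intro j
    obtain ⟨l, hl, hl' | hl'⟩ := hcases j <;> obtain ⟨h1, h2, h3⟩ := h l hl <;> rw [hl'] <;>
      constructor <;> linarith
  have : Nonempty (Fin m) := ⟨(hadj _ hs.choose_spec).choose⟩
  choose! J hJ using hadj
  have hJinj : ∀ i ∈ s, ∀ j ∈ s, J i = J j → i = j := by
    intro i hi j hj hij
    by_contra hne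
    have huu : u i = u j := by rw [← (hJ i hi).1, ← (hJ j hj).1, hij]
    refine disjoint_left.1 (hd i hi j hj hne) (left_mem_Icc.2 (h i hi).2.1.le) ?_
    rw [huu]
    exact left_mem_Icc.2 (h j hj).2.1.le
  let G : Fin m → ℝ≥0∞ := fun j => ENNReal.ofReal
    (|f (e j.castSucc : UnitAddCircle) - f (e j.succ : UnitAddCircle)| ^ p)
  calc ∑ i ∈ s, ENNReal.ofReal (|f (u i : UnitAddCircle) - f (v i : UnitAddCircle)| ^ p)
      = ∑ i ∈ s, G (J i) :=
        Finset.sum_congr rfl fun i hi => by rw [← (hJ i hi).1, ← (hJ i hi).2]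
    _ = ∑ j ∈ s.image J, G j := (Finset.sum_image hJinj).symm
    _ ≤ ∑ j, G j := Finset.sum_le_sum_of_subset (Finset.subset_univ _)
    _ ≤ pVariation p f := sum_le_pVariation_of_strictMono p he hmem

theorem exists_crossingBound_of_pVariation_ne_top {p : ℝ} (hp : 0 ≤ p) (h : pVariation p f ≠ ⊤) :
    ∃ C, CrossingBound f p C := by
  -- Each crossing inside `(0,1)` costs `δ ^ p` of variation; the `+ 1` pays for the one that may
  -- pass through `0`, since `δ ^ (-p) ≥ 1`.
  refine ⟨(pVariation p f).toReal + 1, fun δ h0 h1 n hn => ?_⟩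
  obtain ⟨s, u, v, hs, huv, hd⟩ := hn.exists_intervals h0
  have h2 := sum_le_pVariation (f := f) p s u v
    (fun i hi => ⟨(huv i hi).1.le, (huv i hi).2.1, (huv i hi).2.2.1.le⟩) hd
  have h3 : ENNReal.ofReal (s.card * δ ^ p) ≤ pVariation p f := by
    refine le_trans ?_ h2
    rw [ENNReal.ofReal_mul (Nat.cast_nonneg _), ENNReal.ofReal_natCast, ← nsmul_eq_mul]
    refine Finset.card_nsmul_le_sum _ _ _ fun i hi => ?_
    exact ENNReal.ofReal_le_ofReal (Real.rpow_le_rpow h0.le (huv i hi).2.2.2 hp)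
  have h4 : s.card * δ ^ p ≤ (pVariation p f).toReal := (ENNReal.ofReal_le_iff_le_toReal h).1 h3
  have h5 : 1 ≤ δ ^ (-p) := Real.one_le_rpow_of_pos_of_le_one_of_nonpos h0 h1 (by linarith)
  have h6 : (s.card : ℝ) ≤ (pVariation p f).toReal * δ ^ (-p) := by
    rw [Real.rpow_neg h0.le, ← div_eq_mul_inv, le_div_iff₀ (Real.rpow_pos_of_pos h0 _)]
    exact h4
  have h7 : (n : ℝ) ≤ s.card + 1 := by exact_mod_cast hs
  linarith

end Crossings

/-! ### The tree's dimension equals the variation index. -/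

section TreeDimension

/-- The distance is the sum of the two non-negative drops from `x` and `y` to the minimum, and the
minimum is at most `e z`. -/
theorem Excursion.sub_le_dist (e : Excursion) {x y z : unitInterval} (hz : z ∈ uIcc x y) :
    e.toFun y - e.toFun z ≤ e.dist x y := by
  have h1 := e.minOn_le hz
  have h2 := e.minOn_le (left_mem_uIcc : x ∈ uIcc x y)
  unfold Excursion.dist
  linarith

theorem Excursion.abs_sub_le_dist (e : Excursion) (x y : unitInterval) :
    |e.toFun x - e.toFun y| ≤ e.dist x y := by
  rw [abs_sub_le_iff]
  constructor
  · rw [e.dist_comm]; exact e.sub_le_dist left_mem_uIcc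
  · exact e.sub_le_dist left_mem_uIcc

variable (f : C(UnitAddCircle, ℝ))

/-- The point of the tree of `f` coded by `x`. -/
noncomputable def treeMk (x : unitInterval) : Tree f :=
  SeparationQuotient.mk (show TreePoint (excursion f) from x)

theorem treeMk_surjective : Function.Surjective (treeMk f) :=
  SeparationQuotient.surjective_mk (X := TreePoint (excursion f))

theorem dist_treeMk (x y : unitInterval) :
    dist (treeMk f x) (treeMk f y) = (excursion f).dist x y :=
  SeparationQuotient.dist_mk _ _

/-- `f` read from its minimiser. -/
noncomputable def rotated : C(UnitAddCircle, ℝ) := timeChange f (Homeomorph.addRight (argmin f))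

theorem excursion_apply (x : unitInterval) :
    (excursion f).toFun x = rotated f ((x : ℝ) : UnitAddCircle) - f (argmin f) := rfl

theorem hasCrossings_rotated_iff {δ : ℝ} {n : ℕ} :
    HasCrossings (rotated f) δ n ↔ HasCrossings f δ n := hasCrossings_timeChange_iff _

/-- The height descends to a 1-Lipschitz function on the tree, and its range contains a
nondegenerate interval because `f` is not constant. -/
theorem one_le_upperBoxDim_tree (hf : ¬ ∃ c : ℝ, ∀ x, f x = c) : 1 ≤ upperBoxDim (Tree f) := by
  have hex : ∃ y, f (argmin f) < f y := by
    by_contra! h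
    exact hf ⟨f (argmin f), fun x => le_antisymm (h x) (argmin_le f x)⟩
  obtain ⟨y, hy⟩ := hex
  obtain ⟨t, ht⟩ : ∃ t : unitInterval, (excursion f).toFun t = f y - f (argmin f) := by
    obtain ⟨x, hx, hxy⟩ := exists_coe_eq (y - argmin f)
    refine ⟨⟨x, hx.1, hx.2.le⟩, ?_⟩
    change f ((x : UnitAddCircle) + argmin f) - f (argmin f) = _
    rw [hxy, sub_add_cancel]
  let φ : Tree f → ℝ := fun z => (excursion f).toFun ((treeMk_surjective f z).choose)
  have hφ : ∀ x, φ (treeMk f x) = (excursion f).toFun x := by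
    intro x
    have h1 := (treeMk_surjective f (treeMk f x)).choose_spec
    have h2 : dist (treeMk f (treeMk_surjective f (treeMk f x)).choose) (treeMk f x) = 0 := by
      rw [h1, _root_.dist_self]
    rw [dist_treeMk] at h2
    have h3 := (excursion f).abs_sub_le_dist (treeMk_surjective f (treeMk f x)).choose x
    rw [h2] at h3
    exact sub_eq_zero.1 (abs_nonpos_iff.1 h3)
  refine one_le_upperBoxDim φ ?_ (sub_pos.2 hy) ?_
  · intro a b
    obtain ⟨x, rfl⟩ := treeMk_surjective f a
    obtain ⟨z, rfl⟩ := treeMk_surjective f b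
    rw [hφ, hφ, dist_treeMk]
    exact (excursion f).abs_sub_le_dist x z
  · intro c hc
    have := intermediate_value_univ (0 : unitInterval) t (excursion f).toFun.continuous
    rw [(excursion f).map_zero, ht] at this
    obtain ⟨x, hx⟩ := this hc
    exact ⟨treeMk f x, by rw [hφ, hx]⟩

/-- A dip of depth `δ` between two points, measured from the higher one, puts them at tree distance
at least `δ > r`, so no covering set contains both. -/
theorem card_le_of_crossings {δ r : ℝ} (hr : 0 ≤ r) (hrδ : r < δ) {m : ℕ}
    (hm : coverNumber (Tree f) r ≤ m) {ι : Type*} (s : Finset ι) (w : ι → unitInterval)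
    (hw : ∀ i ∈ s, ∀ j ∈ s, i ≠ j → ∃ z ∈ uIcc (w i) (w j),
      (excursion f).toFun z + δ ≤ max ((excursion f).toFun (w i)) ((excursion f).toFun (w j))) :
    s.card ≤ m := by
  have h := card_le_coverNumber hr (fun i : s => treeMk f (w i)) ?_
  · have h2 := h.trans hm
    rw [Fintype.card_coe] at h2
    exact_mod_cast h2
  · intro i j hij
    obtain ⟨z, hz, hz2⟩ := hw i i.2 j j.2 fun h' => hij (Subtype.ext h')
    rw [dist_treeMk]
    rcases le_max_iff.1 hz2 with h1 | h1
    · rw [uIcc_comm] at hz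
      have := (excursion f).sub_le_dist hz
      rw [(excursion f).dist_comm]
      linarith
    · have := (excursion f).sub_le_dist hz
      linarith

/-- Mark the top of each crossing: the right end of an up-crossing, the left end of a down-crossing.
Between two tops of the same type lies the bottom of one of them, so each type occurs at most `m`
times. The `+ 1` is the crossing through the base point. -/
theorem HasCrossings.le_of_coverNumber_le {f : C(UnitAddCircle, ℝ)} {δ r : ℝ} (hr : 0 ≤ r)
    (hrδ : r < δ) {n m : ℕ} (h : HasCrossings f δ n) (hm : coverNumber (Tree f) r ≤ m) :
    n ≤ 2 * m + 1 := by
  classical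
  have hδ : 0 < δ := hr.trans_lt hrδ
  obtain ⟨s, u, v, hs, huv, hd⟩ := ((hasCrossings_rotated_iff f).2 h).exists_intervals hδ
  let P : ℝ → unitInterval := fun x => projIcc 0 1 zero_le_one x
  have hP : ∀ x : ℝ, 0 < x → x < 1 → (P x : ℝ) = x := fun x h0 h1 => by
    simp only [P, projIcc_of_mem zero_le_one (⟨h0.le, h1.le⟩ : x ∈ Icc (0 : ℝ) 1)]
  have heP : ∀ x : ℝ, 0 < x → x < 1 →
      (excursion f).toFun (P x) = rotated f (x : UnitAddCircle) - f (argmin f) := fun x h0 h1 => by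
    rw [excursion_apply, hP x h0 h1]
  have hPm : Monotone P := monotone_projIcc _
  have hsep : ∀ i ∈ s, ∀ j ∈ s, i ≠ j → v i ≤ u j ∨ v j ≤ u i := by
    intro i hi j hj hij
    by_contra! hcon
    have h1 := (huv i hi).2.1
    have h2 := (huv j hj).2.1
    have hmax : max (u i) (u j) ∉ Icc (u j) (v j) := by
      refine disjoint_left.1 (hd i hi j hj hij) ⟨le_max_left _ _, ?_⟩
      exact max_le h1.le hcon.1.le
    exact hmax ⟨le_max_right _ _, max_le hcon.2.le h2.le⟩
  have hup : (s.filter fun i => rotated f (u i : UnitAddCircle) + δ ≤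
      rotated f (v i : UnitAddCircle)).card ≤ m := by
    refine card_le_of_crossings f hr hrδ hm _
      (fun i => P (v i)) ?_
    intro i hi j hj hij
    obtain ⟨hi, hi'⟩ := Finset.mem_filter.1 hi
    obtain ⟨hj, hj'⟩ := Finset.mem_filter.1 hj
    obtain ⟨a1, a2, a3, -⟩ := huv i hi
    obtain ⟨b1, b2, b3, -⟩ := huv j hj
    rcases hsep i hi j hj hij with h1 | h1
    · refine ⟨P (u j), Icc_subset_uIcc ⟨hPm h1, hPm b2.le⟩, le_max_of_le_right ?_⟩
      rw [heP _ b1 (by linarith), heP _ (by linarith) b3]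
      linarith
    · refine ⟨P (u i), Icc_subset_uIcc' ⟨hPm h1, hPm a2.le⟩, le_max_of_le_left ?_⟩
      rw [heP _ a1 (by linarith), heP _ (by linarith) a3]
      linarith
  have hdown : (s.filter fun i => ¬ rotated f (u i : UnitAddCircle) + δ ≤
      rotated f (v i : UnitAddCircle)).card ≤ m := by
    refine card_le_of_crossings f hr hrδ hm _
      (fun i => P (u i)) ?_
    intro i hi j hj hij
    obtain ⟨hi, hi'⟩ := Finset.mem_filter.1 hi
    obtain ⟨hj, hj'⟩ := Finset.mem_filter.1 hj
    obtain ⟨a1, a2, a3, a4⟩ := huv i hi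
    obtain ⟨b1, b2, b3, b4⟩ := huv j hj
    rcases hsep i hi j hj hij with h1 | h1
    · refine ⟨P (v i), Icc_subset_uIcc ⟨hPm a2.le, hPm h1⟩, le_max_of_le_left ?_⟩
      rw [heP _ a1 (by linarith), heP _ (by linarith) a3]
      rcases le_abs.1 a4 with h5 | h5 <;> linarith
    · refine ⟨P (v j), Icc_subset_uIcc' ⟨hPm b2.le, hPm h1⟩, le_max_of_le_right ?_⟩
      rw [heP _ b1 (by linarith), heP _ (by linarith) b3]
      rcases le_abs.1 b4 with h5 | h5 <;> linarith
  have := Finset.card_filter_add_card_filter_not (s := s)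
    (fun i => rotated f (u i : UnitAddCircle) + δ ≤ rotated f (v i : UnitAddCircle))
  omega

/-- Between neighbours, one of the two drops to the minimum is at least `ε / 2`; passing to the open
gap halves it again. -/
theorem hasCrossings_of_separated {ε : ℝ} (hε : 0 < ε) {m : ℕ} (t : Finset unitInterval)
    (ht : t.card = m + 1)
    (hsep : ∀ x ∈ t, ∀ y ∈ t, x ≠ y → ε ≤ (excursion f).dist x y) :
    HasCrossings f (ε / 4) m := by
  rw [← hasCrossings_rotated_iff]
  set x := t.orderEmbOfFin ht
  have hmem : ∀ j, x j ∈ t := fun j => Finset.orderEmbOfFin_mem _ _ _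
  have hlt : ∀ j : Fin m, ((x j.castSucc : unitInterval) : ℝ) < x j.succ := fun j =>
    x.strictMono Fin.castSucc_lt_succ
  have hsub : ∀ j : Fin m, Ioo (x j.castSucc : ℝ) (x j.succ) ⊆ Ico 0 1 := fun j y hy =>
    ⟨(x j.castSucc).2.1.trans hy.1.le, hy.2.trans_le (x j.succ).2.2⟩
  have hdis : ∀ i j : Fin m, i < j → Disjoint (Ioo (x i.castSucc : ℝ) (x i.succ))
      (Ioo (x j.castSucc : ℝ) (x j.succ)) := fun i j hij => by
    have h1 : (x i.succ : ℝ) ≤ x j.castSucc := x.monotone (Fin.succ_le_castSucc_iff.2 hij)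
    rw [disjoint_left]
    intro y hy hy'
    linarith [hy.2, hy'.1]
  refine ⟨fun j => (fun y : ℝ => (y : UnitAddCircle)) '' Ioo (x j.castSucc : ℝ) (x j.succ),
    fun j => isPreconnected_image_coe isPreconnected_Ioo,
    fun i j hij => disjoint_image_coe (hsub i) (hsub j) ?_, fun j => ?_⟩
  · rcases lt_or_gt_of_ne hij with h' | h'
    · exact hdis i j h'
    · exact (hdis j i h').symm
  have h1 := hsep _ (hmem j.castSucc) _ (hmem j.succ)
    (fun h => absurd (hlt j) (by rw [h]; exact lt_irrefl _))
  obtain ⟨z, hz, hze⟩ := (excursion f).exists_eq_minOn (x j.castSucc) (x j.succ)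
  rw [uIcc_of_le (show x j.castSucc ≤ x j.succ from (hlt j).le)] at hz
  have hz1 : (x j.castSucc : ℝ) ≤ z := hz.1
  have hz2 : (z : ℝ) ≤ x j.succ := hz.2
  unfold Excursion.dist at h1
  rw [← hze, excursion_apply, excursion_apply, excursion_apply] at h1
  set g : ℝ → ℝ := fun y => rotated f (y : UnitAddCircle) with hg
  have hgc : Continuous g := continuous_comp_coe _
  have main : ∀ a b : ℝ, (x j.castSucc : ℝ) ≤ a → a ≤ b → b ≤ x j.succ → ε / 2 ≤ |g a - g b| →
      ∃ a' ∈ (fun y : ℝ => (y : UnitAddCircle)) '' Ioo (x j.castSucc : ℝ) (x j.succ),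
      ∃ b' ∈ (fun y : ℝ => (y : UnitAddCircle)) '' Ioo (x j.castSucc : ℝ) (x j.succ),
        ε / 4 ≤ |rotated f a' - rotated f b'| := by
    intro a b ha hab hb hle
    have hlt : a < b := by
      refine lt_of_le_of_ne hab fun h => ?_
      rw [h, sub_self, abs_zero] at hle
      linarith
    obtain ⟨a', ha', b', hb', h⟩ := exists_mem_Ioo_half_le hgc hlt
    have hss : Ioo a b ⊆ Ioo (x j.castSucc : ℝ) (x j.succ) := Ioo_subset_Ioo ha hb
    exact ⟨_, ⟨a', hss ha', rfl⟩, _, ⟨b', hss hb', rfl⟩, by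
      change |g a - g b| / 2 ≤ |g a' - g b'| at h
      change ε / 4 ≤ |g a' - g b'|
      linarith⟩
  rcases le_total (ε / 2) (g (x j.castSucc) - g z) with h | h
  · exact main _ _ le_rfl hz1 hz2 (h.trans (le_abs_self _))
  · refine main _ _ hz1 hz2 le_rfl ?_
    rw [abs_sub_comm]
    refine le_trans ?_ (le_abs_self _)
    simp only [hg] at h ⊢
    linarith

/-- Balls of radius `r / 2` around a maximal `r / 2`-separated set cover the tree. Its gaps are
crossings of size `r / 8`, whence `8 ^ q`, and it has one more point than gaps. -/
theorem CrossingBound.upperBoxDim_tree_le {f : C(UnitAddCircle, ℝ)} {q C : ℝ} (hq : 0 ≤ q)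
    (h : CrossingBound f q C) : upperBoxDim (Tree f) ≤ ENNReal.ofReal q := by
  classical
  refine upperBoxDim_le_of_eventually (C := C * 8 ^ q + 1) ?_
  filter_upwards [eventually_pos_lt_nhdsGT one_pos] with r hr
  set ε := r / 2 with hε
  have hε0 : 0 < ε := by rw [hε]; linarith [hr.1]
  let P : Finset unitInterval → Prop := fun t =>
    ∀ x ∈ t, ∀ y ∈ t, x ≠ y → ε ≤ (excursion f).dist x y
  have hr8 : (ε / 4) ^ (-q) = 8 ^ q * r ^ (-q) := by
    rw [show ε / 4 = 8⁻¹ * r by rw [hε]; ring, Real.mul_rpow (by norm_num) hr.1.le,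
      Real.inv_rpow (by norm_num), Real.rpow_neg (by norm_num), inv_inv]
  have hone : 1 ≤ r ^ (-q) :=
    Real.one_le_rpow_of_pos_of_le_one_of_nonpos hr.1 hr.2.le (by linarith)
  have hbound : ∀ t, P t → (t.card : ℝ) ≤ (C * 8 ^ q + 1) * r ^ (-q) := by
    intro t ht
    -- Non-negativity comes from applying the bound to the empty family.
    have hC : 0 ≤ C * (ε / 4) ^ (-q) := by
      refine (Nat.cast_nonneg 0).trans (h (ε / 4) (by linarith) (by linarith) 0 ?_)
      exact ⟨fun i => i.elim0, fun i => i.elim0, fun i => i.elim0, fun i => i.elim0⟩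
    rcases Nat.eq_zero_or_pos t.card with h0 | h0
    · rw [h0]
      rw [hr8] at hC
      push_cast
      linarith
    · obtain ⟨m, hm⟩ := Nat.exists_eq_succ_of_ne_zero h0.ne'
      have := h (ε / 4) (by linarith) (by linarith) m (hasCrossings_of_separated f hε0 t hm ht)
      rw [hr8] at this
      rw [hm]
      push_cast
      linarith
  let K : Set ℕ := {k | ∃ t, P t ∧ t.card = k}
  have hKne : K.Nonempty := ⟨0, ∅, fun x hx => absurd hx (Finset.notMem_empty x), rfl⟩
  have hKb : BddAbove K := by
    refine ⟨⌊(C * 8 ^ q + 1) * r ^ (-q)⌋₊, ?_⟩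
    rintro _ ⟨t, ht, rfl⟩
    exact Nat.le_floor (hbound t ht)
  obtain ⟨t, ht, htc⟩ := Nat.sSup_mem hKne hKb
  refine ⟨t.card, ?_, hbound t ht⟩
  have hcov := coverNumber_le_card (X := Tree f) (r := r) (ι := t)
    (fun x => treeMk f '' {y | (excursion f).dist x y ≤ ε}) ?_ ?_
  · rwa [Fintype.card_coe] at hcov
  · intro x
    refine Metric.ediam_le ?_
    rintro _ ⟨y, hy, rfl⟩ _ ⟨z, hz, rfl⟩
    rw [edist_dist, dist_treeMk]
    refine ENNReal.ofReal_le_ofReal ?_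
    have h1 := (excursion f).dist_triangle y x z
    rw [(excursion f).dist_comm y x] at h1
    have hy' : (excursion f).dist x y ≤ ε := hy
    have hz' : (excursion f).dist x z ≤ ε := hz
    linarith
  · rw [eq_univ_iff_forall]
    intro w
    obtain ⟨y, rfl⟩ := treeMk_surjective f w
    by_contra hcon
    have hfar : ∀ x ∈ t, ε < (excursion f).dist x y := by
      intro x hx
      by_contra hle
      exact hcon (mem_iUnion.2 ⟨⟨x, hx⟩, y, not_lt.1 hle, rfl⟩)
    have hyt : y ∉ t := fun hy => by
      have := hfar y hy
      rw [(excursion f).dist_self] at this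
      linarith
    have hP : P (insert y t) := by
      intro a ha b hb hab
      rcases Finset.mem_insert.1 ha with ha | ha <;> rcases Finset.mem_insert.1 hb with hb | hb
      · exact absurd (ha.trans hb.symm) hab
      · rw [ha, (excursion f).dist_comm]; exact (hfar b hb).le
      · rw [hb]; exact (hfar a ha).le
      · exact ht a ha b hb hab
    have hle := le_csSup hKb ⟨_, hP, rfl⟩
    rw [Finset.card_insert_of_notMem hyt, ← htc] at hle
    omega

theorem one_le_variationIndex : 1 ≤ variationIndex f := le_sup_left

theorem ofReal_le_variationIndex {p : ℝ} (hp : 1 ≤ p) (h : pVariation p f = ⊤) :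
    ENNReal.ofReal p ≤ variationIndex f :=
  le_sup_of_le_right (le_iSup_of_le p (le_iSup_of_le hp (le_iSup_of_le h le_rfl)))

theorem exists_crossingBound_of_variationIndex_lt {f : C(UnitAddCircle, ℝ)} {p : ℝ}
    (h : variationIndex f < ENNReal.ofReal p) : ∃ C, CrossingBound f p C := by
  have hp : 1 ≤ p := by
    have := (one_le_variationIndex f).trans h.le
    rwa [ENNReal.one_le_ofReal] at this
  exact exists_crossingBound_of_pVariation_ne_top (by linarith) fun htop =>
    absurd h (not_lt.2 (ofReal_le_variationIndex f hp htop))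

theorem upperBoxDim_tree_eq_variationIndex (hf : ¬ ∃ c : ℝ, ∀ x, f x = c) :
    upperBoxDim (Tree f) = variationIndex f := by
  apply le_antisymm
  · refine le_of_forall_gt_imp_ge_of_dense fun c hc => ?_
    rcases eq_or_ne c ⊤ with rfl | hct
    · exact le_top
    rw [← ENNReal.ofReal_toReal hct] at hc ⊢
    obtain ⟨C, hC⟩ := exists_crossingBound_of_variationIndex_lt hc
    exact hC.upperBoxDim_tree_le ENNReal.toReal_nonneg
  · refine sup_le (one_le_upperBoxDim_tree f hf)
      (iSup_le fun p => iSup_le fun hp => iSup_le fun hV => ?_)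
    by_contra! hcon
    obtain ⟨q, hq0, hq1, hq2⟩ := ENNReal.lt_iff_exists_real_btwn.1 hcon
    have hqp : q < p := (ENNReal.ofReal_lt_ofReal_iff (by linarith)).1 hq2
    have hq : 0 < q := by
      by_contra hneg
      rw [ENNReal.ofReal_of_nonpos (not_lt.1 hneg)] at hq1
      exact not_lt_bot hq1
    -- Crossings of size `δ` are counted by covers at a strictly smaller scale, here `δ / 2`.
    have hhalf : Tendsto (fun δ : ℝ => δ / 2) (𝓝[>] 0) (𝓝[>] 0) := by
      refine tendsto_nhdsWithin_iff.2 ⟨?_, ?_⟩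
      · have : Continuous fun δ : ℝ => δ / 2 := by fun_prop
        simpa using (this.tendsto 0).mono_left nhdsWithin_le_nhds
      · filter_upwards [eventually_pos_lt_nhdsGT one_pos] with δ hδ
        exact half_pos hδ.1
    obtain ⟨C, hC⟩ := exists_crossingBound_of_eventually (f := f) (C := 2 * 2 ^ q + 1) hq.le (by
      filter_upwards [hhalf.eventually (eventually_coverNumber_le_of_upperBoxDim_lt hq1),
        eventually_pos_lt_nhdsGT one_pos] with δ ⟨m, hm, hmq⟩ hδ n hn
      have h1 : (n : ℝ) ≤ 2 * m + 1 := by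
        exact_mod_cast hn.le_of_coverNumber_le (half_pos hδ.1).le (half_lt_self hδ.1) hm
      have h2 : (δ / 2) ^ (-q) = 2 ^ q * δ ^ (-q) := by
        rw [show δ / 2 = 2⁻¹ * δ by ring, Real.mul_rpow (by norm_num) hδ.1.le,
          Real.inv_rpow (by norm_num), Real.rpow_neg (by norm_num), inv_inv]
      have h3 : 1 ≤ δ ^ (-q) :=
        Real.one_le_rpow_of_pos_of_le_one_of_nonpos hδ.1 hδ.2.le (by linarith)
      rw [h2] at hmq
      linarith)
    exact hC.pVariation_ne_top hq hqp hV

end TreeDimension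

/-! ### Upper bound for the dimension of the graph. -/

section GraphUpperBound

theorem exists_half_diam_le_dist {S : Set ℝ} (hS : S.Nonempty) :
    ∃ a ∈ S, ∃ b ∈ S, Metric.diam S / 2 ≤ dist a b := by
  by_contra! h
  have h0 : 0 ≤ Metric.diam S := Metric.diam_nonneg
  have h1 : Metric.diam S ≤ Metric.diam S / 2 :=
    Metric.diam_le_of_forall_dist_le (by linarith) fun a ha b hb => (h a ha b hb).le
  obtain ⟨a, ha⟩ := hS
  have := h a ha a ha
  rw [_root_.dist_self] at this
  linarith

theorem euclidean_dist_le {p q : EuclideanSpace ℝ (Fin 2)} {r : ℝ} (hr : 0 ≤ r)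
    (h0 : |p 0 - q 0| ≤ r / 2) (h1 : |p 1 - q 1| ≤ r / 2) : dist p q ≤ r := by
  rw [EuclideanSpace.dist_eq, Fin.sum_univ_two, Real.dist_eq, Real.dist_eq]
  refine Real.sqrt_le_iff.2 ⟨hr, ?_⟩
  have a0 := abs_nonneg (p 0 - q 0)
  have a1 := abs_nonneg (p 1 - q 1)
  nlinarith

/-- The half-open arc `[i/n, (i+1)/n)` of the circle. -/
def arc (n i : ℕ) : Set UnitAddCircle :=
  (fun x : ℝ => (x : UnitAddCircle)) '' Ico ((i : ℝ) / n) ((i + 1) / n)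

theorem Ico_div_subset {n i : ℕ} (hi : i < n) :
    Ico ((i : ℝ) / n) ((i + 1) / n) ⊆ Ico 0 1 := by
  have hn : (0 : ℝ) < n := by exact_mod_cast (Nat.zero_le i).trans_lt hi
  have h1 : ((i : ℝ) + 1) / n ≤ 1 := by
    rw [div_le_one hn]; exact_mod_cast hi
  exact Ico_subset_Ico (by positivity) h1

theorem isPreconnected_arc (n i : ℕ) : IsPreconnected (arc n i) :=
  isPreconnected_image_coe isPreconnected_Ico

theorem disjoint_arc {n i j : ℕ} (hi : i < n) (hj : j < n) (hij : i ≠ j) :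
    Disjoint (arc n i) (arc n j) := by
  have hn : (0 : ℝ) < n := by exact_mod_cast (Nat.zero_le i).trans_lt hi
  refine disjoint_image_coe (Ico_div_subset hi) (Ico_div_subset hj) ?_
  rw [disjoint_left]
  rintro x ⟨h1, h2⟩ ⟨h3, h4⟩
  rw [div_le_iff₀ hn] at h1 h3
  rw [lt_div_iff₀ hn] at h2 h4
  have h5 : i < j + 1 := by exact_mod_cast h1.trans_lt h4
  have h6 : j < i + 1 := by exact_mod_cast h3.trans_lt h2
  omega

variable (g : C(UnitAddCircle, ℝ))

/-- A cover of the graph by squares: the number of squares over each arc is governed by the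
oscillation of the function on that arc. -/
theorem coverNumber_graph_le {r : ℝ} (hr : 0 < r) {n : ℕ} (hn : 0 < n) (hnr : 2 / r ≤ n)
    (M : Fin n → ℝ) (hM : ∀ i : Fin n, ∀ x ∈ arc n i, ∀ y ∈ arc n i, |g x - g y| ≤ M i) :
    coverNumber (graph g) r ≤ (1 + ∑ i, (⌊4 * M i / r⌋₊ + 1) : ℕ) := by
  have hn' : (0 : ℝ) < n := by exact_mod_cast hn
  have hnr' : 1 / (n : ℝ) ≤ r / 2 := by
    rw [div_le_iff₀ hr] at hnr
    rw [div_le_iff₀ hn']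
    linarith
  let c : Fin n → ℝ := fun i => (i : ℝ) / n
  have hc : ∀ i : Fin n, ((c i : ℝ) : UnitAddCircle) ∈ arc n i := fun i =>
    ⟨c i, ⟨le_rfl, by
      change (i : ℝ) / n < (i + 1) / n
      exact div_lt_div_of_pos_right (by linarith) hn'⟩, rfl⟩
  -- Over arc `i` the values lie in a window of length `2 * M i`, cut into pieces of height `r / 2`.
  -- The case `none` is the end point over `1`, which no half-open arc contains.
  let U : Option (Σ i : Fin n, Fin (⌊4 * M i / r⌋₊ + 1)) → Set (graph g)
    | none => {p | p.1 0 = 1}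
    | some ⟨i, j⟩ => {p | p.1 0 ∈ Ico ((i : ℝ) / n) ((i + 1) / n) ∧
        p.1 1 - g (c i : UnitAddCircle) + M i ∈ Icc ((j : ℝ) * (r / 2)) ((j + 1) * (r / 2))}
  have hcov := coverNumber_le_card (r := r) U ?_ ?_
  · rw [Fintype.card_option, Fintype.card_sigma] at hcov
    simp only [Fintype.card_fin] at hcov
    rwa [add_comm] at hcov
  · rintro (_ | ⟨i, j⟩)
    · refine Metric.ediam_le ?_
      rintro ⟨_, x, hx, rfl⟩ h1 ⟨_, y, hy, rfl⟩ h2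
      have h1' : x = 1 := by simpa [U] using h1
      have h2' : y = 1 := by simpa [U] using h2
      subst h1' h2'
      rw [edist_self]
      exact zero_le
    · refine Metric.ediam_le ?_
      rintro ⟨p, hp⟩ ⟨h1, h2⟩ ⟨q, hq⟩ ⟨h3, h4⟩
      rw [edist_dist]
      refine ENNReal.ofReal_le_ofReal ?_
      rw [Subtype.dist_eq]
      have h5 : ((i : ℝ) + 1) / n = (i : ℝ) / n + 1 / n := by ring
      refine euclidean_dist_le hr.le ?_ ?_
      · simp only [h5] at h1 h3
        rw [abs_le]
        constructor <;> linarith [h1.1, h1.2, h3.1, h3.2]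
      · rw [abs_le]
        constructor <;> nlinarith [h2.1, h2.2, h4.1, h4.2]
  · rw [eq_univ_iff_forall]
    rintro ⟨_, x, hx, rfl⟩
    rw [mem_iUnion]
    rcases hx.2.eq_or_lt with h1 | h1
    · exact ⟨none, by simp [U, h1]⟩
    have hin : ⌊x * n⌋₊ < n := by
      rw [Nat.floor_lt (mul_nonneg hx.1 hn'.le)]
      nlinarith
    let i : Fin n := ⟨⌊x * n⌋₊, hin⟩
    have hxi : x ∈ Ico ((i : ℝ) / n) ((i + 1) / n) := by
      constructor
      · rw [div_le_iff₀ hn']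
        exact Nat.floor_le (mul_nonneg hx.1 hn'.le)
      · rw [lt_div_iff₀ hn']
        exact Nat.lt_floor_add_one _
    have hosc := hM i _ ⟨x, hxi, rfl⟩ _ (hc i)
    simp only at hosc
    have hosc' := abs_le.1 hosc
    set y := g (x : UnitAddCircle) - g (c i : UnitAddCircle) + M i with hy
    have hy0 : 0 ≤ y := by rw [hy]; linarith
    have hr2 : 0 < r / 2 := half_pos hr
    have hj : ⌊y / (r / 2)⌋₊ < ⌊4 * M i / r⌋₊ + 1 := by
      refine Nat.lt_succ_of_le (Nat.floor_le_floor ?_)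
      rw [div_le_iff₀ hr2]
      have : 4 * M i / r * (r / 2) = 2 * M i := by field_simp; ring
      rw [this, hy]
      linarith
    refine ⟨some ⟨i, ⟨⌊y / (r / 2)⌋₊, hj⟩⟩, ?_, ?_⟩
    · simpa using hxi
    · have h2 := Nat.floor_le (a := y / (r / 2)) (by positivity)
      have h3 := Nat.lt_floor_add_one (y / (r / 2))
      rw [le_div_iff₀ hr2] at h2
      rw [div_lt_iff₀ hr2] at h3
      exact ⟨by simpa using h2, by simpa using h3.le⟩

theorem upperBoxDim_graph_le {θ K : ℝ} (hθ : θ ≤ 1)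
    (h : ∀ n : ℕ, 0 < n → ∀ a b : Fin n → UnitAddCircle, (∀ i : Fin n, a i ∈ arc n i) →
      (∀ i : Fin n, b i ∈ arc n i) → ∑ i, |g (a i) - g (b i)| ≤ K * (n : ℝ) ^ (1 - θ)) :
    upperBoxDim (graph g) ≤ ENNReal.ofReal (2 - θ) := by
  -- With `n ≤ 3 / r` arcs, `4` covers the extra set and one box per arc; `8` is the `4` of the box
  -- count, doubled because the chosen points realise only half of each diameter.
  refine upperBoxDim_le_of_eventually (C := 4 + 8 * K * 3 ^ (1 - θ)) ?_
  filter_upwards [eventually_pos_lt_nhdsGT one_pos] with r ⟨hr0, hr1⟩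
  set n := ⌈2 / r⌉₊ with hn
  have hn0 : 0 < n := Nat.ceil_pos.2 (by positivity)
  have hn0' : (0 : ℝ) < n := by exact_mod_cast hn0
  have hnr : 2 / r ≤ n := Nat.le_ceil _
  have hn3 : (n : ℝ) ≤ 3 / r := by
    have h1 : (n : ℝ) < 2 / r + 1 := Nat.ceil_lt_add_one (by positivity)
    have h2 : 1 ≤ 1 / r := by rw [le_div_iff₀ hr0]; linarith
    have h3 : 3 / r = 2 / r + 1 / r := by ring
    linarith
  have hne : ∀ i : Fin n, (g '' arc n i).Nonempty := fun i =>
    ((nonempty_Ico.2 (div_lt_div_of_pos_right (by linarith) hn0')).image _).image _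
  have hex : ∀ i : Fin n, ∃ a ∈ arc n i, ∃ b ∈ arc n i,
      Metric.diam (g '' arc n i) / 2 ≤ |g a - g b| := by
    intro i
    obtain ⟨_, ⟨a, ha, rfl⟩, _, ⟨b, hb, rfl⟩, hab⟩ := exists_half_diam_le_dist (hne i)
    exact ⟨a, ha, b, hb, hab⟩
  choose a ha b hb hab using hex
  have hbdd : ∀ i : Fin n, Bornology.IsBounded (g '' arc n i) := fun i =>
    (isCompact_range g.continuous).isBounded.subset (image_subset_range _ _)
  refine ⟨_, coverNumber_graph_le g hr0 hn0 hnr (fun i => Metric.diam (g '' arc n i))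
    (fun i x hx y hy => Metric.dist_le_diam_of_mem (hbdd i) ⟨x, hx, rfl⟩ ⟨y, hy, rfl⟩), ?_⟩
  have hsum := h n hn0 a b ha hb
  have hK : 0 ≤ K := by
    have h1 : 0 ≤ K * (n : ℝ) ^ (1 - θ) :=
      (Finset.sum_nonneg fun i _ => abs_nonneg _).trans hsum
    exact nonneg_of_mul_nonneg_left h1 (Real.rpow_pos_of_pos hn0' _)
  have hs1 : ∑ i : Fin n, ((⌊4 * Metric.diam (g '' arc n i) / r⌋₊ : ℝ) + 1) ≤
      n + 8 / r * ∑ i, |g (a i) - g (b i)| := by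
    rw [Finset.sum_add_distrib, Finset.mul_sum]
    have h1 : ∑ i : Fin n, (⌊4 * Metric.diam (g '' arc n i) / r⌋₊ : ℝ) ≤
        ∑ i, 8 / r * |g (a i) - g (b i)| := by
      refine Finset.sum_le_sum fun i _ => ?_
      refine (Nat.floor_le (by have := Metric.diam_nonneg (s := g '' arc n i); positivity)).trans ?_
      rw [div_mul_eq_mul_div]
      refine div_le_div_of_nonneg_right ?_ hr0.le
      linarith [hab i]
    have h2 : ∑ _i : Fin n, (1 : ℝ) = n := by simp
    linarith
  have hpow : (n : ℝ) ^ (1 - θ) ≤ 3 ^ (1 - θ) * r ^ (-(1 - θ)) := by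
    calc (n : ℝ) ^ (1 - θ) ≤ (3 / r) ^ (1 - θ) :=
          Real.rpow_le_rpow hn0'.le hn3 (by linarith)
      _ = _ := by
          rw [Real.div_rpow (by norm_num) hr0.le, Real.rpow_neg hr0.le, div_eq_mul_inv]
  have hr2 : r⁻¹ * r ^ (-(1 - θ)) = r ^ (-(2 - θ)) := by
    rw [← Real.rpow_neg_one, ← Real.rpow_add hr0]
    congr 1
    ring
  have hle1 : 1 / r ≤ r ^ (-(2 - θ)) := by
    rw [← hr2, one_div]
    refine le_mul_of_one_le_right (by positivity) ?_
    exact Real.one_le_rpow_of_pos_of_le_one_of_nonpos hr0 hr1.le (by linarith)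
  have hle0 : 1 ≤ 1 / r := by rw [le_div_iff₀ hr0]; linarith
  push_cast
  have h8 : 8 / r * ∑ i, |g (a i) - g (b i)| ≤ 8 * K * 3 ^ (1 - θ) * r ^ (-(2 - θ)) := by
    calc 8 / r * ∑ i, |g (a i) - g (b i)| ≤ 8 / r * (K * (3 ^ (1 - θ) * r ^ (-(1 - θ)))) := by
          refine mul_le_mul_of_nonneg_left (hsum.trans ?_) (by positivity)
          exact mul_le_mul_of_nonneg_left hpow hK
      _ = 8 * K * 3 ^ (1 - θ) * (r⁻¹ * r ^ (-(1 - θ))) := by ring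
      _ = _ := by rw [hr2]
  have h9 : 3 / r = 3 * (1 / r) := by ring
  linarith

theorem upperBoxDim_graph_le_two : upperBoxDim (graph g) ≤ 2 := by
  obtain ⟨M, hM⟩ := exists_forall_abs_sub_le g
  have := upperBoxDim_graph_le g (θ := 0) (K := M) zero_le_one fun n _ a b _ _ => by
    calc ∑ i, |g (a i) - g (b i)| ≤ ∑ _i : Fin n, M := Finset.sum_le_sum fun i _ => hM _ _
      _ = M * (n : ℝ) ^ ((1 : ℝ) - 0) := by simp [mul_comm]
  simpa using this

variable {g}

/-- Hölder over `n` disjoint arcs, whose `p`-th power sums are bounded, gives total oscillation of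
order `n ^ (1 - 1 / p)`. -/
theorem CrossingBound.upperBoxDim_graph_le {q C p : ℝ} (h : CrossingBound g q C) (hq : 0 < q)
    (hqp : q < p) (hp : 1 ≤ p) : upperBoxDim (graph g) ≤ ENNReal.ofReal (2 - 1 / p) := by
  obtain ⟨K, hK, hsum⟩ := h.exists_sum_le hq hqp
  have hp0 : 0 < p := by linarith
  refine CircleTree.upperBoxDim_graph_le g (θ := 1 / p) (K := K.toReal ^ (1 / p))
    (by rw [div_le_one hp0]; exact hp) fun n hn a b ha hb => ?_
  have hn0 : (0 : ℝ) < n := by exact_mod_cast hn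
  have h1 : ∑ i, |g (a i) - g (b i)| ^ p ≤ K.toReal := by
    have h2 := hsum n (fun i => arc n i) a b (fun i => isPreconnected_arc n i)
      (fun i j hij => disjoint_arc i.2 j.2 fun h' => hij (Fin.ext h')) ha hb
    rw [← ENNReal.ofReal_sum_of_nonneg fun i _ => Real.rpow_nonneg (abs_nonneg _) _] at h2
    exact (ENNReal.ofReal_le_iff_le_toReal hK).1 h2
  have h2 := Real.rpow_sum_le_const_mul_sum_rpow Finset.univ (fun i => g (a i) - g (b i)) hp
  rw [Finset.card_univ, Fintype.card_fin] at h2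
  have h0 : 0 ≤ ∑ i, |g (a i) - g (b i)| := Finset.sum_nonneg fun i _ => abs_nonneg _
  calc ∑ i, |g (a i) - g (b i)| = ((∑ i, |g (a i) - g (b i)|) ^ p) ^ (1 / p) := by
        rw [← Real.rpow_mul h0, mul_one_div_cancel hp0.ne', Real.rpow_one]
    _ ≤ ((n : ℝ) ^ (p - 1) * K.toReal) ^ (1 / p) := by
        refine Real.rpow_le_rpow (Real.rpow_nonneg h0 _) (h2.trans ?_) (by positivity)
        exact mul_le_mul_of_nonneg_left h1 (by positivity)
    _ = _ := by
        rw [Real.mul_rpow (by positivity) ENNReal.toReal_nonneg, ← Real.rpow_mul hn0.le, mul_comm]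
        congr 2
        field_simp

/-- Crossing bounds ignore `τ`, so every finite `p` above the index works; let `p` decrease to it.
An infinite index leaves the trivial bound 2. -/
theorem upperBoxDim_graph_timeChange_le (f : C(UnitAddCircle, ℝ))
    (τ : UnitAddCircle ≃ₜ UnitAddCircle) :
    upperBoxDim (graph (timeChange f τ)) ≤ 2 - 1 / variationIndex f := by
  rcases eq_or_ne (variationIndex f) ⊤ with hI | hI
  · rw [hI]
    simpa using upperBoxDim_graph_le_two _
  have h1 := one_le_variationIndex f
  set I := (variationIndex f).toReal with hIr
  have hof : variationIndex f = ENNReal.ofReal I := (ENNReal.ofReal_toReal hI).symm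
  have hI1 : 1 ≤ I := by rwa [hof, ENNReal.one_le_ofReal] at h1
  have hI0 : 0 < I := by linarith
  have key : ∀ p > I, upperBoxDim (graph (timeChange f τ)) ≤ ENNReal.ofReal (2 - 1 / p) := by
    intro p hp
    obtain ⟨q, hq1, hq2⟩ := exists_between hp
    obtain ⟨C, hC⟩ := exists_crossingBound_of_variationIndex_lt (f := f) (p := q) (by
      rw [hof]; exact (ENNReal.ofReal_lt_ofReal_iff (by linarith)).2 hq1)
    exact (hC.timeChange τ).upperBoxDim_graph_le (by linarith) hq2 (by linarith)
  have hlim : Tendsto (fun p : ℝ => ENNReal.ofReal (2 - 1 / p)) (𝓝[>] I)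
      (𝓝 (ENNReal.ofReal (2 - 1 / I))) := by
    refine Tendsto.mono_left ?_ nhdsWithin_le_nhds
    refine (ENNReal.continuous_ofReal.tendsto _).comp ?_
    exact tendsto_const_nhds.sub (tendsto_const_nhds.div tendsto_id hI0.ne')
  have h2 := ge_of_tendsto hlim (eventually_mem_nhdsWithin.mono key)
  rw [ENNReal.ofReal_sub _ (by positivity), ENNReal.ofReal_div_of_pos hI0, ENNReal.ofReal_one,
    ← hof] at h2
  simpa using h2

end GraphUpperBound

/-! ### Building time changes from distribution functions. -/

section TimeChange

/-- An increasing bijection of `[0,1]` induces a homeomorphism of the circle. -/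
theorem exists_homeomorph_of_strictMono {F : ℝ → ℝ} (hc : Continuous F) (hm : StrictMono F)
    (h0 : F 0 = 0) (h1 : F 1 = 1) :
    ∃ φ : UnitAddCircle ≃ₜ UnitAddCircle, ∀ x ∈ Icc (0 : ℝ) 1,
      φ (x : UnitAddCircle) = (F x : UnitAddCircle) := by
  have h10 : ((1 : ℝ) : UnitAddCircle) = 0 := AddCircle.coe_period 1
  let G : UnitAddCircle → UnitAddCircle := AddCircle.liftIco 1 0 fun x => (F x : UnitAddCircle)
  have hGc : Continuous G := by
    refine AddCircle.liftIco_continuous ?_ ?_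
    · simp [h0, h1, h10]
    · exact ((AddCircle.continuous_mk' (1 : ℝ)).comp hc).continuousOn
  have hG : ∀ x ∈ Ico (0 : ℝ) 1, G (x : UnitAddCircle) = (F x : UnitAddCircle) := fun x hx =>
    AddCircle.liftIco_coe_apply (p := (1 : ℝ)) (a := 0)
      (f := fun x => (F x : UnitAddCircle)) (by simpa using hx)
  have hFmem : ∀ x ∈ Ico (0 : ℝ) 1, F x ∈ Ico (0 : ℝ) 1 := fun x hx =>
    ⟨h0 ▸ hm.monotone hx.1, h1 ▸ hm hx.2⟩
  have hbij : Function.Bijective G := by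
    constructor
    · intro y z hyz
      obtain ⟨x, hx, rfl⟩ := exists_coe_eq y
      obtain ⟨w, hw, rfl⟩ := exists_coe_eq z
      rw [hG x hx, hG w hw] at hyz
      rw [hm.injective (coe_inj_of_mem_Ico (hFmem x hx) (hFmem w hw) hyz)]
    · intro y
      obtain ⟨x, hx, rfl⟩ := exists_coe_eq y
      obtain ⟨w, hw, hwx⟩ := intermediate_value_Icc zero_le_one hc.continuousOn
        (show x ∈ Icc (F 0) (F 1) by rw [h0, h1]; exact Ico_subset_Icc_self hx)
      have hw1 : w < 1 := by
        rw [← hm.lt_iff_lt, hwx, h1]; exact hx.2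
      exact ⟨w, by rw [hG w ⟨hw.1, hw1⟩, hwx]⟩
  refine ⟨Continuous.homeoOfEquivCompactToT2 (f := Equiv.ofBijective G hbij) hGc,
    fun x hx => ?_⟩
  change G x = _
  rcases hx.2.eq_or_lt with rfl | hx1
  · have := hG 0 ⟨le_rfl, one_pos⟩
    rw [h0] at this
    rw [h10, h1, h10]
    exact this
  · exact hG x ⟨hx.1, hx1⟩

/-- A distribution function on `[0,1]` that charges each of finitely many intervals equally. -/
theorem exists_monotone_charging {N : ℕ} (hN : 0 < N) (a c : Fin N → ℝ)
    (h : ∀ i, 0 ≤ a i ∧ a i < c i ∧ c i ≤ 1) :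
    ∃ G : ℝ → ℝ, Continuous G ∧ Monotone G ∧ (∀ x, G x ∈ Icc (0 : ℝ) 1) ∧ G 0 = 0 ∧ G 1 = 1 ∧
      ∀ i, 1 / (N : ℝ) ≤ G (c i) - G (a i) := by
  have hN0 : (0 : ℝ) < N := by exact_mod_cast hN
  -- The distribution function of the uniform measure on `[a i, c i]`; their average is the required
  -- function.
  let H : Fin N → ℝ → ℝ := fun i x => max 0 (min 1 ((x - a i) / (c i - a i)))
  have hpos : ∀ i, 0 < c i - a i := fun i => sub_pos.2 (h i).2.1
  have hHm : ∀ i, Monotone (H i) := fun i x y hxy =>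
    max_le_max le_rfl (min_le_min le_rfl
      (div_le_div_of_nonneg_right (by linarith) (hpos i).le))
  have hH0 : ∀ i x, x ≤ a i → H i x = 0 := fun i x hx =>
    max_eq_left ((min_le_right _ _).trans
      (div_nonpos_of_nonpos_of_nonneg (by linarith) (hpos i).le))
  have hH1 : ∀ i x, c i ≤ x → H i x = 1 := fun i x hx => by
    have : 1 ≤ (x - a i) / (c i - a i) := by rw [le_div_iff₀ (hpos i)]; linarith
    simp only [H]
    rw [min_eq_left this, max_eq_right zero_le_one]
  have hH01 : ∀ i x, H i x ∈ Icc (0 : ℝ) 1 := fun i x =>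
    ⟨le_max_left _ _, max_le zero_le_one (min_le_left _ _)⟩
  refine ⟨fun x => 1 / (N : ℝ) * ∑ i, H i x, ?_, ?_, ?_, ?_, ?_, ?_⟩
  · refine continuous_const.mul (continuous_finsetSum _ fun i _ => ?_)
    exact continuous_const.max (continuous_const.min
      ((continuous_id.sub continuous_const).div_const _))
  · intro x y hxy
    exact mul_le_mul_of_nonneg_left (Finset.sum_le_sum fun i _ => hHm i hxy) (by positivity)
  · intro x
    refine ⟨mul_nonneg (by positivity) (Finset.sum_nonneg fun i _ => (hH01 i x).1), ?_⟩
    have : ∑ i, H i x ≤ ∑ _i : Fin N, (1 : ℝ) := Finset.sum_le_sum fun i _ => (hH01 i x).2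
    rw [Finset.sum_const, Finset.card_univ, Fintype.card_fin, nsmul_eq_mul, mul_one] at this
    rw [one_div, inv_mul_le_iff₀ hN0]
    linarith
  · simp [hH0 _ _ (h _).1]
  · simp only [hH1 _ _ (h _).2.2]
    simp [hN0.ne']
  · intro i
    simp only
    rw [← mul_sub, ← Finset.sum_sub_distrib]
    refine le_mul_of_one_le_right (by positivity) ?_
    have h1 : H i (c i) - H i (a i) = 1 := by rw [hH1 i _ le_rfl, hH0 i _ le_rfl, sub_zero]
    rw [← h1]
    exact Finset.single_le_sum (f := fun j => H j (c i) - H j (a i))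
      (fun j _ => sub_nonneg.2 (hHm j (h i).2.1.le)) (Finset.mem_univ i)

/-- A mixture of countably many distribution functions on `[0,1]` and the uniform one. -/
theorem exists_strictMono_mixture (G : ℕ → ℝ → ℝ) (hc : ∀ k, Continuous (G k))
    (hm : ∀ k, Monotone (G k)) (h01 : ∀ k x, G k x ∈ Icc (0 : ℝ) 1) (h0 : ∀ k, G k 0 = 0)
    (h1 : ∀ k, G k 1 = 1) :
    ∃ F : ℝ → ℝ, Continuous F ∧ StrictMono F ∧ F 0 = 0 ∧ F 1 = 1 ∧
      ∀ k x y, x ≤ y → (1 / 2 : ℝ) ^ (k + 2) * (G k y - G k x) ≤ F y - F x := by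
  -- The weights use half of the mass; the other half goes to the identity and makes the mixture
  -- strictly increasing.
  have hw : HasSum (fun k : ℕ => (1 / 2 : ℝ) ^ (k + 2)) (1 / 2) := by
    have := hasSum_geometric_two.mul_left (1 / 4 : ℝ)
    have h : (fun k : ℕ => (1 / 2 : ℝ) ^ (k + 2)) = fun k => 1 / 4 * (1 / 2) ^ k := by
      funext k; ring
    have h' : (1 / 4 : ℝ) * 2 = 1 / 2 := by norm_num
    rwa [h', ← h] at this
  have hbd : ∀ k x, ‖(1 / 2 : ℝ) ^ (k + 2) * G k x‖ ≤ (1 / 2 : ℝ) ^ (k + 2) := fun k x => by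
    rw [Real.norm_of_nonneg (mul_nonneg (by positivity) (h01 k x).1)]
    exact mul_le_of_le_one_right (by positivity) (h01 k x).2
  have hsum : ∀ x, Summable fun k => (1 / 2 : ℝ) ^ (k + 2) * G k x := fun x =>
    Summable.of_norm_bounded hw.summable fun k => hbd k x
  have hdiff : ∀ k x y, x ≤ y → (1 / 2 : ℝ) ^ (k + 2) * (G k y - G k x) ≤
      ∑' k, (1 / 2 : ℝ) ^ (k + 2) * G k y - ∑' k, (1 / 2 : ℝ) ^ (k + 2) * G k x := by
    intro k x y hxy
    rw [← (hsum y).tsum_sub (hsum x), mul_sub]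
    refine ((hsum y).sub (hsum x)).le_tsum k fun j _ => ?_
    exact sub_nonneg.2 (mul_le_mul_of_nonneg_left (hm j hxy) (by positivity))
  have hnn : ∀ k x y, x ≤ y → 0 ≤ (1 / 2 : ℝ) ^ (k + 2) * (G k y - G k x) := fun k x y hxy =>
    mul_nonneg (by positivity) (sub_nonneg.2 (hm k hxy))
  refine ⟨fun x => x / 2 + ∑' k, (1 / 2 : ℝ) ^ (k + 2) * G k x, ?_, ?_, ?_, ?_, ?_⟩
  · refine (continuous_id.div_const 2).add ?_
    exact continuous_tsum (fun k => continuous_const.mul (hc k)) hw.summable hbd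
  · intro x y hxy
    have := (hnn 0 x y hxy.le).trans (hdiff 0 x y hxy.le)
    simp only
    linarith
  · simp [h0]
  · simp only [h1, mul_one]
    rw [hw.tsum_eq]
    norm_num
  · intro k x y hxy
    have := hdiff k x y hxy
    simp only
    linarith

end TimeChange

/-! ### A time change attaining the bound. -/

section GraphLowerBound

variable {f : C(UnitAddCircle, ℝ)}

theorem abs_sub_apply_le_dist (p q : EuclideanSpace ℝ (Fin 2)) (i : Fin 2) :
    |p i - q i| ≤ dist p q := by
  have := PiLp.dist_apply_le p q i
  rwa [Real.dist_eq] at this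

/-- Intervals `[aᵢ, bᵢ] ⊆ [0,1]` at positive distance from each other, together with points
`aᵢ < cᵢ ≤ bᵢ` such that `f` oscillates by at least `η` on `[cᵢ, bᵢ]`. -/
structure OscillatingIntervals (f : C(UnitAddCircle, ℝ)) (η : ℝ) {N : ℕ} (a c b : Fin N → ℝ) :
    Prop where
  nonneg : ∀ i, 0 ≤ a i
  lt : ∀ i, a i < c i
  le : ∀ i, c i ≤ b i
  le_one : ∀ i, b i ≤ 1
  osc : ∀ i, η ≤ |f (c i : UnitAddCircle) - f (b i : UnitAddCircle)|
  sep : ∀ i j, i ≠ j → b i ≤ a j ∨ b j ≤ a i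

/-- Giving up half of the oscillation frees a gap `[u, c]` that can be stretched while the
oscillation on `[c, b]` remains. -/
theorem HasCrossings.exists_oscillatingIntervals {δ : ℝ} (hδ : 0 < δ) {n : ℕ}
    (h : HasCrossings f δ n) : ∃ (N : ℕ) (a c b : Fin N → ℝ), n ≤ N + 1 ∧
      OscillatingIntervals f (δ / 2) a c b := by
  obtain ⟨s, u, v, hs, huv, hd⟩ := h.exists_intervals hδ
  have hex : ∀ i : s, ∃ c b : ℝ, u i < c ∧ c ≤ b ∧ b < v i ∧
      δ / 2 ≤ |f (c : UnitAddCircle) - f (b : UnitAddCircle)| := by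
    intro i
    obtain ⟨h0, hlt, h1, hosc⟩ := huv i i.2
    obtain ⟨x, hx, y, hy, hxy⟩ := exists_mem_Ioo_half_le (continuous_comp_coe f) hlt
    have h2 : δ / 2 ≤ |f (x : UnitAddCircle) - f (y : UnitAddCircle)| := by linarith
    rcases le_total x y with hle | hle
    · exact ⟨x, y, hx.1, hle, hy.2, h2⟩
    · exact ⟨y, x, hy.1, hle, hx.2, by rwa [abs_sub_comm]⟩
  choose c b hc1 hc2 hc3 hc4 using hex
  refine ⟨s.card, fun i => u (s.equivFin.symm i), fun i => c (s.equivFin.symm i),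
    fun i => b (s.equivFin.symm i), hs, fun i => (huv _ (s.equivFin.symm i).2).1.le,
    fun i => hc1 _, fun i => hc2 _,
    fun i => ((hc3 _).trans (huv _ (s.equivFin.symm i).2).2.2.1).le, fun i => hc4 _, ?_⟩
  intro i j hij
  set i' := s.equivFin.symm i
  set j' := s.equivFin.symm j
  have hne : (i' : Fin n) ≠ j' := fun h' => hij (s.equivFin.symm.injective (Subtype.ext h'))
  by_contra! hcon
  have hi := (huv i' i'.2).2.1
  have hj := (huv j' j'.2).2.1
  have hmax : max (u i') (u j') ∉ Icc (u j') (v j') :=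
    disjoint_left.1 (hd i' i'.2 j' j'.2 hne)
      ⟨le_max_left _ _, max_le hi.le (hcon.1.trans (hc3 i')).le⟩
  exact hmax ⟨le_max_right _ _, max_le (hcon.2.trans (hc3 j')).le hj.le⟩

/-- A time change that stretches the gap in front of each oscillation to length `ℓ` makes the graph
large at scale `ℓ / 2`. -/
theorem OscillatingIntervals.le_coverNumber_graph {η ℓ : ℝ} (hη : 0 ≤ η) (hℓ : 0 < ℓ) {N : ℕ}
    {a c b : Fin N → ℝ} (h : OscillatingIntervals f η a c b) {F : ℝ → ℝ} (hF : Monotone F)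
    (hF0 : F 0 = 0) (hF1 : F 1 = 1) (hℓF : ∀ i, ℓ ≤ F (c i) - F (a i))
    {g : C(UnitAddCircle, ℝ)}
    (hg : ∀ x ∈ Icc (0 : ℝ) 1, g (F x : UnitAddCircle) = f (x : UnitAddCircle)) :
    ((N * (⌊η / ℓ⌋₊ + 1) : ℕ) : ℕ∞) ≤ coverNumber (graph g) (ℓ / 2) := by
  -- In each column, pick points whose heights relative to `f (c i)` are multiples of `ℓ` in
  -- absolute value.
  have hex : ∀ (i : Fin N) (j : Fin (⌊η / ℓ⌋₊ + 1)), ∃ x ∈ Icc (c i) (b i),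
      |f (x : UnitAddCircle) - f (c i : UnitAddCircle)| = j * ℓ := by
    intro i j
    have hcont : ContinuousOn
        (fun x : ℝ => |f (x : UnitAddCircle) - f (c i : UnitAddCircle)|) (Icc (c i) (b i)) :=
      (((continuous_comp_coe f).sub continuous_const).abs).continuousOn
    refine intermediate_value_Icc (h.le i) hcont ⟨?_, ?_⟩
    · simp only [sub_self, abs_zero]
      positivity
    · have hj : ((j : ℕ) : ℝ) ≤ ⌊η / ℓ⌋₊ := by exact_mod_cast Nat.lt_succ_iff.1 j.2
      have h1 : (⌊η / ℓ⌋₊ : ℝ) ≤ η / ℓ := Nat.floor_le (by positivity)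
      have h2 : (j : ℝ) * ℓ ≤ η := by
        rw [← le_div_iff₀ hℓ]; exact hj.trans h1
      rw [abs_sub_comm]
      exact h2.trans (h.osc i)
  choose x hx hxj using hex
  have hx01 : ∀ i j, x i j ∈ Icc (0 : ℝ) 1 := fun i j =>
    ⟨((h.nonneg i).trans (h.lt i).le).trans (hx i j).1, (hx i j).2.trans (h.le_one i)⟩
  let P : Fin N × Fin (⌊η / ℓ⌋₊ + 1) → graph g := fun k =>
    ⟨!₂[F (x k.1 k.2), g (F (x k.1 k.2) : UnitAddCircle)], F (x k.1 k.2),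
      ⟨hF0 ▸ hF (hx01 _ _).1, hF1 ▸ hF (hx01 _ _).2⟩, rfl⟩
  have hP0 : ∀ k, (P k).1 0 = F (x k.1 k.2) := fun k => by simp [P]
  have hP1 : ∀ k, (P k).1 1 = f (x k.1 k.2 : UnitAddCircle) := fun k => by
    simp [P, hg _ (hx01 k.1 k.2)]
  -- The stretched gap `[a i', c i']` lies between the two columns.
  have hsep : ∀ i j i' j', b i ≤ a i' → ℓ ≤ F (x i' j') - F (x i j) := by
    intro i j i' j' hb
    have h1 : F (x i j) ≤ F (a i') := hF ((hx i j).2.trans hb)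
    have h2 : F (c i') ≤ F (x i' j') := hF (hx i' j').1
    linarith [hℓF i']
  have hcard := card_le_coverNumber (half_pos hℓ).le P ?_
  · simpa using hcard
  · rintro ⟨i, j⟩ ⟨i', j'⟩ hne
    refine (half_lt_self hℓ).trans_le ?_
    rw [Subtype.dist_eq]
    rcases eq_or_ne i i' with rfl | hi
    · have hj : j ≠ j' := fun h' => hne (by rw [h'])
      refine le_trans ?_ (abs_sub_apply_le_dist _ _ 1)
      rw [hP1, hP1]
      have h4 : (1 : ℝ) ≤ |((j : ℕ) : ℝ) - ((j' : ℕ) : ℝ)| := by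
        have h5 : (1 : ℤ) ≤ |((j : ℕ) : ℤ) - ((j' : ℕ) : ℤ)| := by
          apply Int.one_le_abs
          rw [sub_ne_zero]
          exact_mod_cast fun h => hj (Fin.ext h)
        exact_mod_cast h5
      calc ℓ ≤ |((j : ℕ) : ℝ) - ((j' : ℕ) : ℝ)| * ℓ := le_mul_of_one_le_left hℓ.le h4
        _ = |(j : ℝ) * ℓ - (j' : ℝ) * ℓ| := by rw [← sub_mul, abs_mul, abs_of_pos hℓ]
        _ = |(|f (x i j : UnitAddCircle) - f (c i : UnitAddCircle)| -
              |f (x i j' : UnitAddCircle) - f (c i : UnitAddCircle)|)| := by rw [hxj, hxj]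
        _ ≤ |(f (x i j : UnitAddCircle) - f (c i : UnitAddCircle)) -
              (f (x i j' : UnitAddCircle) - f (c i : UnitAddCircle))| := abs_abs_sub_abs_le _ _
        _ = _ := by rw [sub_sub_sub_cancel_right]
    · refine le_trans ?_ (abs_sub_apply_le_dist _ _ 0)
      rw [hP0, hP0]
      rcases h.sep i i' hi with h1 | h1
      · rw [abs_sub_comm]
        exact (hsep i j i' j' h1).trans (le_abs_self _)
      · exact (hsep i' j' i j h1).trans (le_abs_self _)

/-- Some `p' > p` has infinite variation, so crossing counts exceed `δ ^ (-p)` at arbitrarily small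
`δ`. -/
theorem exists_oscillatingIntervals_of_lt_variationIndex {p : ℝ} (hp : 1 ≤ p)
    (h : ENNReal.ofReal p < variationIndex f) (L : ℝ) :
    ∃ (N : ℕ) (η : ℝ) (a c b : Fin N → ℝ), 0 < N ∧ L ≤ N ∧ 0 < η ∧
      (N : ℝ) ^ (-(1 / p)) ≤ 4 * η ∧ OscillatingIntervals f η a c b := by
  have hp0 : 0 < p := by linarith
  obtain ⟨p', hpp', hV⟩ : ∃ p', p < p' ∧ pVariation p' f = ⊤ := by
    rcases lt_sup_iff.1 h with h1 | h1
    · exact absurd h1 (not_lt.2 (ENNReal.one_le_ofReal.2 hp))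
    · obtain ⟨p', h1⟩ := lt_iSup_iff.1 h1
      obtain ⟨hp', h1⟩ := lt_iSup_iff.1 h1
      obtain ⟨hV, h1⟩ := lt_iSup_iff.1 h1
      exact ⟨p', (ENNReal.ofReal_lt_ofReal_iff (by linarith)).1 h1, hV⟩
  have hfreq : ∃ᶠ δ : ℝ in 𝓝[>] 0, ∃ n : ℕ, HasCrossings f δ n ∧ δ ^ (-p) < n := by
    intro hcon
    obtain ⟨C, hC⟩ := exists_crossingBound_of_eventually (f := f) (q := p) (C := 1) hp0.le (by
      filter_upwards [hcon] with δ hδ n hn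
      by_contra hlt
      exact hδ ⟨n, hn, by linarith⟩)
    exact hC.pVariation_ne_top hp0 hpp' hV
  -- Taking `δ ^ (-p) ≥ 2 * max L 1` makes the loss of one interval harmless: `δ ^ (-p) ≤ 2 * N`.
  -- This 2 and `η = δ / 2` give the factor 4.
  obtain ⟨δ, ⟨n, hn, hδn⟩, hδL, hδ0, -⟩ := (hfreq.and_eventually
    ((eventually_const_mul_rpow_neg_le hp0 (2 * max L 1)).and
      (eventually_pos_lt_nhdsGT one_pos))).exists
  rw [neg_zero, Real.rpow_zero, mul_one] at hδL
  obtain ⟨N, a, c, b, hnN, hosc⟩ := hn.exists_oscillatingIntervals hδ0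
  have hnN' : (n : ℝ) ≤ N + 1 := by exact_mod_cast hnN
  have hL1 := le_max_right L 1
  have hL := le_max_left L 1
  have hN2 : δ ^ (-p) ≤ 2 * N := by linarith
  have hN0 : (0 : ℝ) < N := by linarith
  refine ⟨N, δ / 2, a, c, b, by exact_mod_cast hN0, by linarith, half_pos hδ0, ?_, hosc⟩
  have h1 : (2 * (N : ℝ)) ^ (-(1 / p)) ≤ δ := by
    calc (2 * (N : ℝ)) ^ (-(1 / p)) ≤ (δ ^ (-p)) ^ (-(1 / p)) :=
          Real.rpow_le_rpow_of_nonpos (Real.rpow_pos_of_pos hδ0 _) hN2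
            (by have : 0 < 1 / p := by positivity
                linarith)
      _ = δ := by
          rw [← Real.rpow_mul hδ0.le, neg_mul_neg, mul_one_div_cancel hp0.ne', Real.rpow_one]
  have h2 : (N : ℝ) ^ (-(1 / p)) = 2 ^ (1 / p) * (2 * (N : ℝ)) ^ (-(1 / p)) := by
    rw [Real.mul_rpow (by norm_num) hN0.le, ← mul_assoc, ← Real.rpow_add (by norm_num)]
    simp
  have h3 : (2 : ℝ) ^ (1 / p) ≤ 2 := by
    calc (2 : ℝ) ^ (1 / p) ≤ 2 ^ (1 : ℝ) :=
          Real.rpow_le_rpow_of_exponent_le (by norm_num) (by rw [div_le_one hp0]; exact hp)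
      _ = 2 := Real.rpow_one 2
  have h4 : (0 : ℝ) ≤ (2 * (N : ℝ)) ^ (-(1 / p)) := by positivity
  rw [h2]
  calc _ ≤ 2 * (2 * (N : ℝ)) ^ (-(1 / p)) := mul_le_mul_of_nonneg_right h3 h4
    _ ≤ 4 * (δ / 2) := by linarith

/-- At scale `ℓ / 2 = 1 / (2^(k+3) N)`, the size of `N` gives `2^(k+3) ≤ N^(1/(k+1))`, so the weight
`2^(-k-2)` only multiplies the exponent by `1 + 1/(k+1)`. -/
theorem rpow_scale_le {s p η : ℝ} {k N : ℕ} (hs : 0 ≤ s) (hN : 0 < N)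
    (hL : (2 : ℝ) ^ ((k + 1) * (k + 3)) ≤ N) (hη : (N : ℝ) ^ (-(1 / p)) ≤ 4 * η)
    (hsp : s * (1 + 1 / ((k : ℝ) + 1)) ≤ 2 - 1 / p) :
    ((1 / 2 : ℝ) ^ (k + 2) * (1 / N) / 2) ^ (-s) ≤ N * (η / ((1 / 2 : ℝ) ^ (k + 2) * (1 / N))) := by
  have hN0 : (0 : ℝ) < N := by exact_mod_cast hN
  have hN1 : (1 : ℝ) ≤ N := by exact_mod_cast hN
  have hk : (0 : ℝ) < (k : ℝ) + 1 := by positivity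
  have h1 : (2 : ℝ) ^ (k + 3) ≤ (N : ℝ) ^ (1 / ((k : ℝ) + 1)) := by
    calc (2 : ℝ) ^ (k + 3) = ((2 : ℝ) ^ ((k + 1) * (k + 3))) ^ (1 / ((k : ℝ) + 1)) := by
          rw [mul_comm, pow_mul, ← Real.rpow_natCast _ (k + 1), ← Real.rpow_mul (by positivity)]
          push_cast
          rw [mul_one_div_cancel hk.ne', Real.rpow_one]
      _ ≤ _ := Real.rpow_le_rpow (by positivity) hL (by positivity)
  have h2 : (1 / 2 : ℝ) ^ (k + 2) * (1 / N) / 2 = (2 ^ (k + 3) * (N : ℝ))⁻¹ := by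
    rw [one_div_pow]
    field_simp
    ring
  have h3 : (2 : ℝ) ^ (k + 3) * N ≤ (N : ℝ) ^ (1 + 1 / ((k : ℝ) + 1)) := by
    rw [Real.rpow_add hN0, Real.rpow_one, mul_comm]
    exact mul_le_mul_of_nonneg_left h1 hN0.le
  have h4 : (4 : ℝ) ≤ 2 ^ (k + 2) := by
    have : (1 : ℝ) ≤ 2 ^ k := one_le_pow₀ (by norm_num)
    rw [pow_add]
    linarith
  have hη0 : 0 ≤ η := by
    have : (0 : ℝ) ≤ (N : ℝ) ^ (-(1 / p)) := by positivity
    linarith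
  calc ((1 / 2 : ℝ) ^ (k + 2) * (1 / N) / 2) ^ (-s) = (2 ^ (k + 3) * (N : ℝ)) ^ s := by
        rw [h2, Real.inv_rpow (by positivity), Real.rpow_neg (by positivity), inv_inv]
    _ ≤ ((N : ℝ) ^ (1 + 1 / ((k : ℝ) + 1))) ^ s := Real.rpow_le_rpow (by positivity) h3 hs
    _ = (N : ℝ) ^ (s * (1 + 1 / ((k : ℝ) + 1))) := by rw [← Real.rpow_mul hN0.le, mul_comm]
    _ ≤ (N : ℝ) ^ (2 - 1 / p) := Real.rpow_le_rpow_of_exponent_le hN1 hsp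
    _ = (N : ℝ) ^ 2 * (N : ℝ) ^ (-(1 / p)) := by
        rw [sub_eq_add_neg, Real.rpow_add hN0]
        norm_cast
    _ ≤ (N : ℝ) ^ 2 * (4 * η) := mul_le_mul_of_nonneg_left hη (by positivity)
    _ ≤ (N : ℝ) ^ 2 * (2 ^ (k + 2) * η) :=
        mul_le_mul_of_nonneg_left (mul_le_mul_of_nonneg_right h4 hη0) (by positivity)
    _ = _ := by
        rw [one_div_pow]
        field_simp

theorem one_le_upperBoxDim_graph (g : C(UnitAddCircle, ℝ)) : 1 ≤ upperBoxDim (graph g) := by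
  refine one_le_upperBoxDim (fun p : graph g => p.1 0) (fun p q => ?_) one_pos ?_
  · rw [Subtype.dist_eq]
    exact abs_sub_apply_le_dist _ _ 0
  · intro x hx
    exact ⟨⟨_, x, hx, rfl⟩, by simp⟩

theorem exists_le_upperBoxDim_graph_timeChange (f : C(UnitAddCircle, ℝ)) :
    ∃ τ : UnitAddCircle ≃ₜ UnitAddCircle,
      2 - 1 / variationIndex f ≤ upperBoxDim (graph (timeChange f τ)) := by
  rcases (one_le_variationIndex f).eq_or_lt with hI | hI
  -- At index 1 the target is 1, attained by any graph since it projects onto `[0,1]`.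
  · refine ⟨Homeomorph.refl _, ?_⟩
    rw [← hI]
    refine le_trans (le_of_eq ?_) (one_le_upperBoxDim_graph _)
    rw [div_one]
    exact ENNReal.sub_eq_of_eq_add ENNReal.one_ne_top (by norm_num)
  obtain ⟨u, -, hu, hulim⟩ := exists_seq_strictMono_tendsto' hI
  have hutop : ∀ k, u k ≠ ⊤ := fun k => (hu k).2.ne_top
  have hup : ∀ k, ENNReal.ofReal (u k).toReal = u k := fun k => ENNReal.ofReal_toReal (hutop k)
  have hp1 : ∀ k, 1 ≤ (u k).toReal := fun k => by
    rw [← ENNReal.one_le_ofReal, hup]; exact (hu k).1.le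
  choose N η a c b hN hL hη hNη hosc using fun k =>
    exists_oscillatingIntervals_of_lt_variationIndex (f := f) (hp1 k) (by rw [hup]; exact (hu k).2)
      ((2 : ℝ) ^ ((k + 1) * (k + 3)))
  choose G hGc hGm hG01 hG0 hG1 hGN using fun k => exists_monotone_charging (hN k) (a k) (c k)
    fun i => ⟨(hosc k).nonneg i, (hosc k).lt i, ((hosc k).le i).trans ((hosc k).le_one i)⟩
  obtain ⟨F, hFc, hFm, hF0, hF1, hFG⟩ := exists_strictMono_mixture G hGc hGm hG01 hG0 hG1
  obtain ⟨φ, hφ⟩ := exists_homeomorph_of_strictMono hFc hFm hF0 hF1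
  -- The inverse, so that the new function at `F x` equals `f` at `x`.
  refine ⟨φ.symm, ?_⟩
  have hN0 : ∀ k, (0 : ℝ) < N k := fun k => by exact_mod_cast hN k
  let ℓ : ℕ → ℝ := fun k => (1 / 2 : ℝ) ^ (k + 2) * (1 / N k)
  have hℓ0 : ∀ k, 0 < ℓ k := fun k => mul_pos (by positivity) (one_div_pos.2 (hN0 k))
  have hcover : ∀ k, ((N k * (⌊η k / ℓ k⌋₊ + 1) : ℕ) : ℕ∞) ≤
      coverNumber (graph (timeChange f φ.symm)) (ℓ k / 2) := by
    intro k
    refine (hosc k).le_coverNumber_graph (hη k).le (hℓ0 k) hFm.monotone hF0 hF1 (fun i => ?_) ?_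
    · refine le_trans ?_ (hFG k _ _ ((hosc k).lt i).le)
      exact mul_le_mul_of_nonneg_left (hGN k i) (by positivity)
    · intro x hx
      rw [← hφ x hx]
      simp [timeChange]
  have hlim0 : Tendsto (fun k => ℓ k / 2) atTop (𝓝[>] 0) := by
    refine tendsto_nhdsWithin_iff.2 ⟨?_, Eventually.of_forall fun k => half_pos (hℓ0 k)⟩
    refine squeeze_zero (fun k => (half_pos (hℓ0 k)).le) (fun k => ?_)
      (tendsto_pow_atTop_nhds_zero_of_lt_one (r := (1 / 2 : ℝ)) (by norm_num) (by norm_num))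
    have h1 : 1 / (N k : ℝ) ≤ 1 := by
      rw [div_le_one (hN0 k)]; exact_mod_cast hN k
    have h2 : (0 : ℝ) < (1 / 2) ^ k := by positivity
    have h3 : ℓ k ≤ (1 / 2 : ℝ) ^ (k + 2) := mul_le_of_le_one_right (by positivity) h1
    rw [pow_add] at h3
    linarith
  refine le_of_forall_lt_imp_le_of_dense fun d hd => ?_
  obtain ⟨t, -, hdt, ht⟩ := ENNReal.lt_iff_exists_real_btwn.1 hd
  have hdtop : d ≠ ⊤ := hdt.ne_top
  have hds : ENNReal.ofReal d.toReal = d := ENNReal.ofReal_toReal hdtop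
  have hst : d.toReal < t := by
    rw [← hds] at hdt
    exact (ENNReal.ofReal_lt_ofReal_iff_of_nonneg ENNReal.toReal_nonneg).1 hdt
  rw [← hds]
  -- For a limsup the scales `ℓ k / 2` suffice; the room between `d` and `t` absorbs the factor `1 +
  -- 1/(k+1)`.
  refine le_upperBoxDim_of_frequently (hlim0.frequently (Eventually.frequently ?_))
  have hev1 : ∀ᶠ k in atTop, ENNReal.ofReal t < 2 - 1 / u k := by
    have : Tendsto (fun k => 2 - 1 / u k) atTop (𝓝 (2 - 1 / variationIndex f)) := by
      simp only [one_div]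
      exact ENNReal.Tendsto.sub tendsto_const_nhds (tendsto_inv_iff.2 hulim)
        (Or.inl (by norm_num))
    exact this.eventually (lt_mem_nhds ht)
  have hev2 : ∀ᶠ k : ℕ in atTop, d.toReal * (1 + 1 / ((k : ℝ) + 1)) < t := by
    have : Tendsto (fun k : ℕ => d.toReal * (1 + 1 / ((k : ℝ) + 1))) atTop
        (𝓝 (d.toReal * (1 + 0))) :=
      (tendsto_const_nhds.add tendsto_one_div_add_atTop_nhds_zero_nat).const_mul _
    rw [add_zero, mul_one] at this
    exact this.eventually (gt_mem_nhds hst)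
  filter_upwards [hev1, hev2] with k hk1 hk2
  refine ⟨_, hcover k, ?_⟩
  have hk3 : t ≤ 2 - 1 / (u k).toReal := by
    have hpos : 0 < (u k).toReal := by linarith [hp1 k]
    have heq : ENNReal.ofReal (2 - 1 / (u k).toReal) = 2 - 1 / u k := by
      rw [ENNReal.ofReal_sub _ (by positivity), ENNReal.ofReal_div_of_pos hpos, ENNReal.ofReal_one,
        hup]
      simp
    rw [← heq] at hk1
    by_contra hlt
    exact absurd hk1 (not_lt.2 (ENNReal.ofReal_le_ofReal (not_le.1 hlt).le))
  refine (rpow_scale_le ENNReal.toReal_nonneg (hN k) (hL k) (hNη k) (by linarith)).trans ?_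
  push_cast
  exact mul_le_mul_of_nonneg_left (Nat.lt_floor_add_one _).le (hN0 k).le

end GraphLowerBound

/-! ### Inverting `d ↦ 2 - 1/d` on `[1, ∞]`, where the truncated subtraction is exact, and
conclusion. -/

theorem inv_two_sub_le_of_le_two_sub_inv {d D : ℝ≥0∞} (hd : 1 ≤ d) (h : D ≤ 2 - 1 / d) :
    1 / (2 - D) ≤ d := by
  have h1 : 1 / d ≤ 2 := by
    rw [one_div]
    exact (ENNReal.inv_le_one.2 hd).trans one_le_two
  have h2 : 1 / d ≤ 2 - D := by
    have h3 := tsub_le_tsub_left h 2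
    rwa [ENNReal.sub_sub_cancel (by norm_num) h1] at h3
  rw [one_div] at h2 ⊢
  exact ENNReal.inv_le_iff_inv_le.1 h2

theorem inv_two_sub_two_sub_inv {d : ℝ≥0∞} (hd : 1 ≤ d) : 1 / (2 - (2 - 1 / d)) = d := by
  have h1 : 1 / d ≤ 2 := by
    rw [one_div]
    exact (ENNReal.inv_le_one.2 hd).trans one_le_two
  rw [ENNReal.sub_sub_cancel (by norm_num) h1, one_div, one_div, inv_inv]

end CircleTree

theorem mainTheorem3 (f : C(UnitAddCircle, ℝ)) (hf : ¬ ∃ c : ℝ, ∀ x, f x = c) :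
    (∃ τ : UnitAddCircle ≃ₜ UnitAddCircle,
      CircleTree.upperBoxDim (CircleTree.graph (CircleTree.timeChange f τ)) =
          2 - 1 / CircleTree.upperBoxDim (CircleTree.Tree f) ∧
        2 - 1 / CircleTree.upperBoxDim (CircleTree.Tree f) =
          2 - 1 / CircleTree.variationIndex f) ∧
    (∀ τ : UnitAddCircle ≃ₜ UnitAddCircle,
      1 / (2 - CircleTree.upperBoxDim (CircleTree.graph (CircleTree.timeChange f τ))) ≤
        CircleTree.upperBoxDim (CircleTree.Tree f)) ∧
    IsGreatest
      (Set.range fun κ : UnitAddCircle ≃ₜ UnitAddCircle =>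
        1 / (2 - CircleTree.upperBoxDim (CircleTree.graph (CircleTree.timeChange f κ))))
      (CircleTree.upperBoxDim (CircleTree.Tree f)) := by
  have hdim := CircleTree.upperBoxDim_tree_eq_variationIndex f hf
  have hone := CircleTree.one_le_variationIndex f
  obtain ⟨τ, hτ⟩ := CircleTree.exists_le_upperBoxDim_graph_timeChange f
  have heq := le_antisymm (CircleTree.upperBoxDim_graph_timeChange_le f τ) hτ
  have hle : ∀ κ : UnitAddCircle ≃ₜ UnitAddCircle,
      1 / (2 - CircleTree.upperBoxDim (CircleTree.graph (CircleTree.timeChange f κ))) ≤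
        CircleTree.variationIndex f := fun κ =>
    CircleTree.inv_two_sub_le_of_le_two_sub_inv hone
      (CircleTree.upperBoxDim_graph_timeChange_le f κ)
  rw [hdim]
  refine ⟨⟨τ, heq, rfl⟩, hle, ⟨τ, ?_⟩, ?_⟩
  · simp only [heq]
    exact CircleTree.inv_two_sub_two_sub_inv hone
  · rintro _ ⟨κ, rfl⟩
    exact hle κ
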